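/- Let $\mathcal G=(\mathcal V,\mathcal E)$ be a finite, simple, connected, undirected graph which has a cycle of even length and whose conductance $\Phi=\min\{\mathrm{cut}(S)/\mathrm{vol}(S) : S\subset\mathcal V,\ 0<\mathrm{vol}(S)\le|\mathcal E|\}$ is at most $1/2$; here $\mathrm{vol}(S)$ is the sum of the degrees of the nodes in $S$ and $\mathrm{cut}(S)$ is the number of edges between $S$ and its complement. Let $D$ and $\mathsf A$ be the degree and adjacency matrices, $L=D-\mathsf A$ the Laplacian, $\omega^\star$ the second largest eigenvalue of $W=D^{-1}\mathsf A$, $\delta=1-\omega^\star$ the spectral gap, and $\Delta=d_{\max}/d_{\min}$ the ratio of the maximum to the minimum degree. For a square matrix $T$ such that $\xi^{t+1}=T\xi^t$ converges to some $\xi^\star$ from every $\xi^0$, the asymptotic convergence rate is $\tau=\lim_{t\to\infty}\bigl(\max_{\|\xi^0\|\le1}\|\xi^t-\xi^\star\|\bigr)^{1/t}$. Gradient descent on $f(z)=\frac12\sum_{(i,j)\in\mathcal E}(z_i-z_j)^2$ with step size $\alpha>0$ is the iteration with matrix $T_G=I-\alpha L$. Distributed over-relaxed ADMM for $f$, with relaxation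 parameter $\gamma\in(0,2)$ and penalty parameter $\rho>0$, is the iteration of messages with matrix $$T_A=I-\gamma(A+B-2BA),\qquad A=(I+\rho^{-1}Q)^{-1},\qquad B=S(S^\top S)^{-1}S^\top,$$ indexed by the pairs $(a,b)$ with $a\in\mathcal E$ and $b$ an end of $a$; here $S_{(a,b),b'}=1$ if $b=b'$ and $0$ otherwise, and $Q$ is block diagonal with one block $\left(\begin{smallmatrix}1&-1\\-1&1\end{smallmatrix}\right)$ for each edge $a$. Let $\tau_G^\star$ and $\tau_A^\star$ be the smallest asymptotic convergence rates over $\alpha$ and over $(\gamma,\rho)$, respectively. Then these minima are attained, $\tau_A^\star=\min_{\gamma,\rho}|\lambda_2(T_A)|$ (with $\lambda_2$ the second largest eigenvalue in absolute value, counted with multiplicity), $0<\delta\le1$, and there is $C=C(\delta)=1-\mathcal O(\sqrt\delta)$ such that $$C\,(1-\tau_G^\star)\ \le\ (1-\tau_A^\star)^2\ \le\ 2\Delta\,C\,(1-\tau_G^\star).$$ More precisely, there are an absolute constant $K$ and a function $C$ of $\delta$ alone, neither depending on $\mathcal G$, with $C(\delta)>0$ and $0\le 1-C(\delta)\le K\sqrt\delta$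 for all $\delta\in(0,1]$, for which both inequalities hold for every such $\mathcal G$. In particular, the square-root speedup holds: there is an absolute constant $c>0$ with $1-\tau_A^\star\ge c\sqrt{1-\tau_G^\star}$ for every such $\mathcal G$. -/

import Mathlib

open Filter Topology

noncomputable section

namespace ADMMSpeedup

/-! ### Linear iterations: asymptotic rate and second eigenvalue -/

/-- `τ` is the asymptotic convergence rate of the linear iteration `ξ (t+1) = T (ξ t)`: the
iteration converges from every starting point (to `P ξ`, where `ξ` is the starting point), and the
worst-case error over the Euclidean unit ball of starting points,
`max_{‖ξ‖ ≤ 1} ‖T ^ t ξ - P ξ‖ = ‖T ^ t - P‖` (operator norm), satisfies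
`lim_{t → ∞} (max_{‖ξ‖ ≤ 1} ‖T ^ t ξ - P ξ‖) ^ (1 / t) = τ`. This is
`log τ = lim_{t → ∞} max_{‖ξ‖ ≤ 1} (1 / t) log ‖T ^ t ξ - P ξ‖`, with `τ = 0` for the limit `-∞`. -/
def HasRate {ι : Type*} [Fintype ι] [DecidableEq ι] (T : Matrix ι ι ℝ) (τ : ℝ) : Prop :=
  ∃ P : Matrix ι ι ℝ,
    Tendsto (fun t : ℕ => T ^ t) atTop (𝓝 P) ∧
    Tendsto (fun t : ℕ => ‖Matrix.toEuclideanCLM (𝕜 := ℝ) (T ^ t - P)‖ ^ ((1 : ℝ) / (t : ℝ)))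
      atTop (𝓝 τ)

/-- `|λ₂(T)|`: the second entry of the list of the moduli of all complex eigenvalues of `T`,
repeated by algebraic multiplicity, in decreasing order `|λ₁| ≥ |λ₂| ≥ ⋯`. -/
def secondModulus {ι : Type*} [Fintype ι] [DecidableEq ι] (T : Matrix ι ι ℝ) : ℝ :=
  (((T.map (algebraMap ℝ ℂ)).charpoly.roots.map (fun z : ℂ => ‖z‖)).sort (· ≥ ·)).getD 1 0

/-- `λ₂(M)`: the second entry of the list of the real eigenvalues of `M`, repeated by algebraic
multiplicity, in decreasing order `λ₁ ≥ λ₂ ≥ ⋯`. -/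
def secondEigenvalue {ι : Type*} [Fintype ι] [DecidableEq ι] (M : Matrix ι ι ℝ) : ℝ :=
  (M.charpoly.roots.sort (· ≥ ·)).getD 1 0

variable {V : Type*} [Fintype V] [DecidableEq V] (G : SimpleGraph V) [DecidableRel G.Adj]

/-! ### The random walk on the graph -/

/-- The transition matrix `W = D⁻¹ A` of the random walk on `G`. -/
def walkMatrix : Matrix V V ℝ := (G.degMatrix ℝ)⁻¹ * G.adjMatrix ℝ

/-- The second largest eigenvalue `ω⋆ = λ₂(W)`. -/
def omegaStar : ℝ := secondEigenvalue (walkMatrix G)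

/-- The spectral gap `δ = 1 - ω⋆`. -/
def spectralGap : ℝ := 1 - omegaStar G

/-- The volume of a set of nodes: the sum of their degrees. -/
def vol (S : Finset V) : ℕ := ∑ i ∈ S, G.degree i

/-- The cut value of `S`: the number of edges between `S` and its complement. -/
def cutValue (S : Finset V) : ℕ := (G.interedges S Sᶜ).card

/-- The conductance `Φ`: the least value of `cut(S) / vol(S)` over the sets `S` of nodes of positive
volume at most half the total volume (the total volume is `2 |E|`). -/
def conductance : ℝ :=
  sInf {r : ℝ | ∃ S : Finset V, 0 < vol G S ∧ vol G S ≤ G.edgeFinset.card ∧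
    r = (cutValue G S : ℝ) / (vol G S : ℝ)}

/-- `Δ`, the ratio of the maximum to the minimum degree. -/
def degreeRatio : ℝ := (G.maxDegree : ℝ) / (G.minDegree : ℝ)

/-- `G` has a cycle of even length. -/
def HasEvenCycle : Prop := ∃ (v : V) (c : G.Walk v v), c.IsCycle ∧ Even c.length

/-! ### Distributed over-relaxed ADMM

The factor graph has one function node per edge `a` of `G`, one variable node per node `b` of `G`,
and an edge `(a, b)` whenever `b` is an end of `a`. The edge `(a, b)` is encoded by the dart of `G`
with underlying edge `a` and first vertex `b`; the other factor-graph edge at the same function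
node is then the reversed dart. -/

/-- The matrix `S`: `S e b = 1` if the factor-graph edge `e` is incident on the variable node
`b`. -/
def incS : Matrix G.Dart V ℝ := Matrix.of fun e b => if e.fst = b then 1 else 0

/-- The block diagonal matrix `Q` with one block `!![1, -1; -1, 1]` per function node. -/
def matQ : Matrix G.Dart G.Dart ℝ :=
  Matrix.of fun e e' => if e' = e then 1 else if e' = e.symm then -1 else 0

/-- `A = (I + ρ⁻¹ Q)⁻¹`. -/
def matA (ρ : ℝ) : Matrix G.Dart G.Dart ℝ := (1 + ρ⁻¹ • matQ G)⁻¹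

/-- `B = S (Sᵀ S)⁻¹ Sᵀ`. -/
def matB : Matrix G.Dart G.Dart ℝ :=
  incS G * ((incS G).transpose * incS G)⁻¹ * (incS G).transpose

/-- The ADMM iteration matrix `T_A = I - γ (A + B - 2 B A)`, acting on the messages `n`. -/
def admmMatrix (γ ρ : ℝ) : Matrix G.Dart G.Dart ℝ :=
  1 - γ • (matA G ρ + matB G - (2 : ℝ) • (matB G * matA G ρ))

/-- The asymptotic convergence rates of ADMM over all relaxation parameters `γ ∈ (0, 2)` and all
penalty parameters `ρ > 0`. -/
def admmRates : Set ℝ :=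
  {τ | ∃ γ ρ : ℝ, 0 < γ ∧ γ < 2 ∧ 0 < ρ ∧ HasRate (admmMatrix G γ ρ) τ}

/-- The values `|λ₂(T_A)|` over all `γ ∈ (0, 2)` and all `ρ > 0`. -/
def admmSecondModuli : Set ℝ :=
  {τ | ∃ γ ρ : ℝ, 0 < γ ∧ γ < 2 ∧ 0 < ρ ∧ τ = secondModulus (admmMatrix G γ ρ)}

/-- The optimal convergence rate `τ⋆_A` of ADMM. -/
def admmOptRate : ℝ := sInf (admmRates G)

/-! ### Gradient descent -/

/-- The gradient-descent iteration matrix `T_G = I - α L` with `L` the graph Laplacian, the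
Hessian of the objective `(1 / 2) ∑_{(i,j) ∈ E} (z i - z j) ^ 2`. -/
def gdMatrix (α : ℝ) : Matrix V V ℝ := 1 - α • G.lapMatrix ℝ

/-- The asymptotic convergence rates of gradient descent over all step sizes `α > 0`. -/
def gdRates : Set ℝ := {τ | ∃ α : ℝ, 0 < α ∧ HasRate (gdMatrix G α) τ}

/-- The optimal convergence rate `τ⋆_G` of gradient descent. -/
def gdOptRate : ℝ := sInf (gdRates G)

end ADMMSpeedup

end

noncomputable section

namespace ADMMSpeedup

/-! ### Sorted lists of eigenvalues -/

/-! Both optimal rates are computed in closed form and then compared through `δ`.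

ADMM. Let `F` be the reversal of darts and put `ρ = 2r`. Then `2A - I = (F + rI)/(1 + r)`, so `T_A =
(1 - γ/2) I + (γ/2)(2B - I)(F + rI)/(1 + r)`. Averaging an eigenvector of `(2B - I)(F + rI)` over
the darts leaving each node reduces its eigenvalue equation to the walk: the eigenvalue `u` is one
of `1 - r`, `-1 - r`, `0`, or a root of `u² - 2ωu + 1 - r² = 0` with `ω` an eigenvalue of `W`
(`eigenvector_classification`). An even cycle, with alternating signs on its edges, realizes `u = -1
- r`, that is, the eigenvalue `1 - γ` of `T_A`. Conductance at most `1/2` forces `ω⋆ ≥ 0`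
(`omegaStar_nonneg`).

Put `s = ω⋆/(1 + √(1 - ω⋆²))`. For every `r`, some root `u` belonging to `ω⋆` gives an eigenvalue of
`T_A` of modulus at least `1 - (γ/2)(1 - s)`. Balancing this with `γ - 1` gives `γ = 4/(3 - s)` and
the lower bound `(1 + s)/(3 - s)` (`exists_large_eigenvalue`). It is attained at `r = √(1 - ω⋆²)`,
where the quadratic for `ω⋆` has a double root (`norm_eigenvalue_le_opt`).

Gradient descent. With `m` and `M` the extreme Laplacian eigenvalues on vectors of sum zero, the
optimal rate is `(M - m)/(M + m)` (`gd_isLeast`). Rayleigh quotients give `d_min δ ≤ m ≤ d_max δ`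
and `d_max ≤ M ≤ 2 d_max`.

Since `δ = (1 - s)²/(1 + s²)`, the ADMM gap is of order `√δ` while the gradient-descent gap is at
most `2δ`; `speedup_bounds` makes this precise.

Rates are tied to eigenvalues by Gelfand's formula (`hasRate_of_stochastic`) for attainment and by
single eigenvectors (`HasRate.norm_eigenvalue_le`) for lower bounds. -/

theorem le_getD_one_sort {m : Multiset ℝ} {a b c : ℝ} (h : {a, b} ≤ m) (ha : c ≤ a)
    (hb : c ≤ b) : c ≤ (m.sort (· ≥ ·)).getD 1 0 := by
  have hs : (m.sort (· ≥ ·)).Pairwise (· ≥ ·) := Multiset.pairwise_sort _ _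
  have hm : ((m.sort (· ≥ ·) : List ℝ) : Multiset ℝ) = m := Multiset.sort_eq _ _
  rw [← hm] at h
  generalize m.sort (· ≥ ·) = l at *
  match l, hs, h with
  | [], _, h => simpa using Multiset.card_le_card h
  | [x], _, h => simpa using Multiset.card_le_card h
  | x :: y :: t, hs, h =>
    simp only [List.getD_cons_succ, List.getD_cons_zero]
    by_contra hlt
    push Not at hlt
    have key : ∀ z ∈ y :: t, z < c := by
      intro z hz
      rcases List.mem_cons.1 hz with rfl | hz
      · exact hlt
      · have := (List.pairwise_cons.1 (List.pairwise_cons.1 hs).2).1 z hz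
        exact lt_of_le_of_lt this hlt
    have hax : a = x := by
      have : a ∈ ((x :: y :: t : List ℝ) : Multiset ℝ) := Multiset.mem_of_le h (by simp)
      rcases List.mem_cons.1 (Multiset.mem_coe.1 this) with h1 | h1
      · exact h1
      · exact absurd (key a h1) (not_lt.2 ha)
    subst hax
    have h2 : ({b} : Multiset ℝ) ≤ ((y :: t : List ℝ) : Multiset ℝ) := by
      have h3 : a ::ₘ ({b} : Multiset ℝ) ≤ a ::ₘ ((y :: t : List ℝ) : Multiset ℝ) := h
      exact (Multiset.cons_le_cons_iff a).1 h3
    exact absurd (key b (Multiset.mem_coe.1 (Multiset.singleton_le.1 h2))) (not_lt.2 hb)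

theorem getD_one_sort_cons {m : Multiset ℝ} {a c : ℝ} (hc : c ∈ m) (hm : ∀ x ∈ m, x ≤ c)
    (ha : c ≤ a) : ((a ::ₘ m).sort (· ≥ ·)).getD 1 0 = c := by
  rw [Multiset.sort_cons (r := (· ≥ ·)) (a := a) (s := m) fun b hb => (hm b hb).trans ha]
  obtain ⟨t, rfl⟩ := Multiset.exists_cons_of_mem hc
  rw [Multiset.sort_cons (r := (· ≥ ·)) (a := c) (s := t)
    fun b hb => hm b (Multiset.mem_cons_of_mem hb)]
  rfl

/-! ### Eigenvalues of matrices -/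

section Field

variable {ι K : Type*} [Fintype ι] [DecidableEq ι] [Field K]

theorem mem_spectrum_iff_exists_mulVec {M : Matrix ι ι K} {μ : K} :
    μ ∈ spectrum K M ↔ ∃ v : ι → K, v ≠ 0 ∧ M.mulVec v = μ • v := by
  rw [spectrum.mem_iff, Matrix.isUnit_iff_isUnit_det, isUnit_iff_ne_zero, not_not,
    ← Matrix.exists_mulVec_eq_zero_iff]
  refine exists_congr fun v => and_congr_right fun _ => ?_
  rw [Matrix.sub_mulVec, sub_eq_zero, eq_comm, Algebra.algebraMap_eq_smul_one, Matrix.smul_mulVec,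
    Matrix.one_mulVec]

theorem mem_roots_charpoly_iff {M : Matrix ι ι K} {μ : K} :
    μ ∈ M.charpoly.roots ↔ ∃ v : ι → K, v ≠ 0 ∧ M.mulVec v = μ • v := by
  rw [Polynomial.mem_roots M.charpoly_monic.ne_zero, ← Matrix.mem_spectrum_iff_isRoot_charpoly,
    mem_spectrum_iff_exists_mulVec]

/-- The left eigenvector `w` annihilates the range of `M - μ` but not `u`, so `u` is not in that
range. No Jordan chain ends at `u`, and the generalized eigenspace is the line through `u`. -/
theorem count_roots_charpoly_eq_one {M : Matrix ι ι K} {μ : K} {u w : ι → K}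
    (hu : M.mulVec u = μ • u) (hw : Matrix.vecMul w M = μ • w) (huw : w ⬝ᵥ u ≠ 0)
    (hs : ∀ v, M.mulVec v = μ • v → ∃ c : K, v = c • u) :
    M.charpoly.rootMultiplicity μ = 1 := by
  classical
  have hu0 : u ≠ 0 := by rintro rfl; simp at huw
  rw [← Matrix.charpoly_toLin', ← LinearMap.finrank_maxGenEigenspace_eq]
  have key : ∀ k : ℕ, ∀ v, ((Matrix.toLin' M - μ • 1) ^ k) v = 0 → ∃ c : K, v = c • u := by
    intro k
    induction k with
    | zero => intro v hv; exact ⟨0, by simpa using hv⟩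
    | succ k ih =>
      intro v hv
      rw [pow_succ] at hv
      obtain ⟨c, hc⟩ := ih _ hv
      have h1 : M.mulVec v - μ • v = c • u := by simpa using hc
      have h2 : w ⬝ᵥ (M.mulVec v - μ • v) = 0 := by
        rw [dotProduct_sub, Matrix.dotProduct_mulVec, hw, smul_dotProduct, dotProduct_smul,
          sub_self]
      rw [h1, dotProduct_smul, smul_eq_mul, mul_eq_zero, or_iff_left huw] at h2
      rw [h2, zero_smul, sub_eq_zero] at h1
      exact hs v h1
  have : Module.End.maxGenEigenspace (Matrix.toLin' M) μ = K ∙ u := by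
    ext v
    rw [Module.End.mem_maxGenEigenspace, Submodule.mem_span_singleton]
    constructor
    · rintro ⟨k, hk⟩
      obtain ⟨c, hc⟩ := key k v hk
      exact ⟨c, hc.symm⟩
    · rintro ⟨c, rfl⟩
      exact ⟨1, by simp [hu]⟩
  rw [this, finrank_span_singleton hu0]

/-- If `μ` is a simple root of the characteristic polynomial, the other roots are the eigenvalues
different from `μ`. -/
theorem roots_charpoly_eq_cons {M : Matrix ι ι K} {μ : K}
    (h : M.charpoly.rootMultiplicity μ = 1) :
    ∃ m : Multiset K, M.charpoly.roots = μ ::ₘ m ∧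
      ∀ x, x ∈ m ↔ x ≠ μ ∧ ∃ v : ι → K, v ≠ 0 ∧ M.mulVec v = x • v := by
  classical
  have hc : M.charpoly.roots.count μ = 1 := by rw [Polynomial.count_roots, h]
  have hmem : μ ∈ M.charpoly.roots := Multiset.count_pos.1 (by omega)
  refine ⟨M.charpoly.roots.erase μ, (Multiset.cons_erase hmem).symm, fun x => ?_⟩
  rw [← mem_roots_charpoly_iff]
  constructor
  · intro hx
    refine ⟨?_, Multiset.mem_of_mem_erase hx⟩
    rintro rfl
    have := Multiset.count_pos.2 hx
    rw [Multiset.count_erase_self] at this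
    omega
  · rintro ⟨h1, h2⟩
    exact (Multiset.mem_erase_of_ne h1).2 h2

end Field

theorem secondEigenvalue_eq {ι : Type*} [Fintype ι] [DecidableEq ι] {M : Matrix ι ι ℝ}
    {μ ω : ℝ} (h : M.charpoly.rootMultiplicity μ = 1) (hω : ω < μ)
    (hv : ∃ v : ι → ℝ, v ≠ 0 ∧ M.mulVec v = ω • v)
    (hmax : ∀ (x : ℝ) (v : ι → ℝ), x ≠ μ → v ≠ 0 → M.mulVec v = x • v → x ≤ ω) :
    secondEigenvalue M = ω := by
  obtain ⟨m, hm, hm'⟩ := roots_charpoly_eq_cons h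
  rw [secondEigenvalue, hm]
  refine getD_one_sort_cons ((hm' ω).2 ⟨hω.ne, hv⟩) (fun x hx => ?_) hω.le
  obtain ⟨h1, v, h2, h3⟩ := (hm' x).1 hx
  exact hmax x v h1 h2 h3

section Complex

variable {ι : Type*} [Fintype ι] [DecidableEq ι]

theorem secondModulus_eq {M : Matrix ι ι ℝ} {τ : ℝ}
    (h : (M.map (algebraMap ℝ ℂ)).charpoly.rootMultiplicity 1 = 1) (hτ : τ ≤ 1)
    (hv : ∃ (l : ℂ) (v : ι → ℂ), l ≠ 1 ∧ ‖l‖ = τ ∧ v ≠ 0 ∧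
      (M.map (algebraMap ℝ ℂ)).mulVec v = l • v)
    (hmax : ∀ (l : ℂ) (v : ι → ℂ), l ≠ 1 → v ≠ 0 →
      (M.map (algebraMap ℝ ℂ)).mulVec v = l • v → ‖l‖ ≤ τ) :
    secondModulus M = τ := by
  obtain ⟨m, hm, hm'⟩ := roots_charpoly_eq_cons h
  rw [secondModulus, hm, Multiset.map_cons]
  obtain ⟨l, v, hl, hlτ, hv0, hlv⟩ := hv
  refine getD_one_sort_cons (Multiset.mem_map.2 ⟨l, (hm' l).2 ⟨hl, v, hv0, hlv⟩, hlτ⟩)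
    (fun x hx => ?_) (by simpa using hτ)
  obtain ⟨z, hz, rfl⟩ := Multiset.mem_map.1 hx
  obtain ⟨h1, v, h2, h3⟩ := (hm' z).1 hz
  exact hmax z v h1 h2 h3

/-- Two distinct eigenvalues of modulus at least `τ` suffice, whatever their multiplicities; this
bounds `|λ₂(T_A)|` below at all parameters, including those where the iteration diverges. -/
theorem le_secondModulus {M : Matrix ι ι ℝ} {τ : ℝ} (hτ : τ ≤ 1) {l : ℂ} {v u : ι → ℂ}
    (hu0 : u ≠ 0) (hu : (M.map (algebraMap ℝ ℂ)).mulVec u = u) (hl : l ≠ 1) (hlτ : τ ≤ ‖l‖)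
    (hv0 : v ≠ 0) (hv : (M.map (algebraMap ℝ ℂ)).mulVec v = l • v) : τ ≤ secondModulus M := by
  have h1 : (1 : ℂ) ∈ (M.map (algebraMap ℝ ℂ)).charpoly.roots :=
    mem_roots_charpoly_iff.2 ⟨u, hu0, by rw [hu, one_smul]⟩
  have h2 : l ∈ (M.map (algebraMap ℝ ℂ)).charpoly.roots := mem_roots_charpoly_iff.2 ⟨v, hv0, hv⟩
  have h3 : ({1, l} : Multiset ℂ) ≤ (M.map (algebraMap ℝ ℂ)).charpoly.roots := by
    rw [Multiset.le_iff_subset (by simpa using hl.symm)]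
    intro x hx
    rcases Multiset.mem_cons.1 hx with rfl | hx
    · exact h1
    · rw [Multiset.mem_singleton.1 hx]; exact h2
  refine le_getD_one_sort (a := 1) (b := ‖l‖) ?_ hτ hlτ
  simpa using Multiset.map_le_map (f := fun z : ℂ => ‖z‖) h3

/-! ### Asymptotic rates -/

/-- Since `k ^ (1/t) → 1`, a rate does not see constant factors, so any equivalent norm may be used.
-/
theorem tendsto_rpow_one_div_of_le {f g : ℕ → ℝ} {c C τ : ℝ} (hc : 0 < c) (hC : 0 < C)
    (hg : ∀ t, 0 ≤ g t) (h1 : ∀ t, c * g t ≤ f t) (h2 : ∀ t, f t ≤ C * g t)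
    (h : Tendsto (fun t : ℕ => g t ^ ((1 : ℝ) / (t : ℝ))) atTop (𝓝 τ)) :
    Tendsto (fun t : ℕ => f t ^ ((1 : ℝ) / (t : ℝ))) atTop (𝓝 τ) := by
  have key : ∀ k : ℝ, 0 < k →
      Tendsto (fun t : ℕ => (k * g t) ^ ((1 : ℝ) / (t : ℝ))) atTop (𝓝 τ) := by
    intro k hk
    have h3 : Tendsto (fun t : ℕ => k ^ ((1 : ℝ) / (t : ℝ))) atTop (𝓝 1) := by
      have := (Real.continuous_const_rpow hk.ne').continuousAt.tendsto.comp
        (tendsto_one_div_atTop_nhds_zero_nat (𝕜 := ℝ))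
      rwa [Real.rpow_zero] at this
    have h4 := h3.mul h
    rw [one_mul] at h4
    refine h4.congr fun t => ?_
    rw [Real.mul_rpow hk.le (hg t)]
  refine tendsto_of_tendsto_of_tendsto_of_le_of_le (key c hc) (key C hC) (fun t => ?_) fun t => ?_
  · exact Real.rpow_le_rpow (mul_nonneg hc.le (hg t)) (h1 t) (by positivity)
  · exact Real.rpow_le_rpow ((mul_nonneg hc.le (hg t)).trans (h1 t)) (h2 t) (by positivity)

/-- The complexification of a real matrix, as an operator on the Euclidean space. -/
def complexCLM : Matrix ι ι ℝ →ₗ[ℝ] (EuclideanSpace ℂ ι →L[ℂ] EuclideanSpace ℂ ι) where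
  toFun M := Matrix.toEuclideanCLM (𝕜 := ℂ) (M.map (algebraMap ℝ ℂ))
  map_add' M N := by
    rw [← map_add]; congr 1; ext i j; simp
  map_smul' c M := by
    have : (c • M).map (algebraMap ℝ ℂ) = (c : ℂ) • M.map (algebraMap ℝ ℂ) := by
      ext i j; simp
    rw [this, map_smul]; ext x; simp

theorem complexCLM_apply (M : Matrix ι ι ℝ) :
    complexCLM M = Matrix.toEuclideanCLM (𝕜 := ℂ) (M.map (algebraMap ℝ ℂ)) := rfl

theorem complexCLM_injective : Function.Injective (complexCLM (ι := ι)) := by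
  intro M N h
  rw [complexCLM_apply, complexCLM_apply] at h
  have h1 := (Matrix.toEuclideanCLM (n := ι) (𝕜 := ℂ)).injective h
  exact Matrix.map_injective (algebraMap ℝ ℂ).injective h1

theorem complexCLM_pow (M : Matrix ι ι ℝ) (t : ℕ) : complexCLM (M ^ t) = complexCLM M ^ t := by
  rw [complexCLM_apply, complexCLM_apply, ← map_pow]
  congr 1
  exact map_pow (algebraMap ℝ ℂ).mapMatrix M t

/-- Complexification is an injective linear map between finite-dimensional spaces, so it distorts
norms by bounded factors only. Gelfand's formula lives over `ℂ`, whereas rates are defined over `ℝ`.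
-/
theorem exists_norm_complexCLM_equiv : ∃ c C : ℝ, 0 < c ∧ 0 < C ∧ ∀ M : Matrix ι ι ℝ,
    c * ‖complexCLM M‖ ≤ ‖Matrix.toEuclideanCLM (𝕜 := ℝ) M‖ ∧
      ‖Matrix.toEuclideanCLM (𝕜 := ℝ) M‖ ≤ C * ‖complexCLM M‖ := by
  let e : Matrix ι ι ℝ ≃ₗ[ℝ] (EuclideanSpace ℝ ι →L[ℝ] EuclideanSpace ℝ ι) :=
    (Matrix.toEuclideanCLM (n := ι) (𝕜 := ℝ)).toAlgEquiv.toLinearEquiv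
  have he : ∀ M, e M = Matrix.toEuclideanCLM (𝕜 := ℝ) M := fun _ => rfl
  have : FiniteDimensional ℝ (EuclideanSpace ℝ ι →L[ℝ] EuclideanSpace ℝ ι) :=
    e.finiteDimensional
  let f := complexCLM.comp e.symm.toLinearMap
  have hf : LinearMap.ker f = ⊥ :=
    LinearMap.ker_eq_bot.2 (complexCLM_injective.comp e.symm.injective)
  have hfe : ∀ M, f (e M) = complexCLM M := fun M => by simp [f]
  obtain ⟨C, hC, hf1⟩ := f.exists_antilipschitzWith hf
  obtain ⟨c, hc, hf2⟩ := (LinearMap.toContinuousLinearMap f).bound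
  refine ⟨c⁻¹, C, inv_pos.2 hc, by exact_mod_cast hC, fun M => ⟨?_, ?_⟩⟩
  · have := hf2 (e M)
    rw [inv_mul_le_iff₀ hc, ← he, ← hfe]
    exact this
  · have := hf1.le_mul_dist (e M) 0
    rw [map_zero, dist_zero_right, dist_zero_right, hfe] at this
    exact this

/-- The limit satisfies `P T = P`, so it kills every eigenvector with `l ≠ 1`. The error on `v` is
then exactly `l ^ t • v`. -/
theorem HasRate.norm_eigenvalue_le {T : Matrix ι ι ℝ} {τ : ℝ} (h : HasRate T τ) {l : ℂ}
    {v : ι → ℂ} (hl : l ≠ 1) (hv0 : v ≠ 0)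
    (hv : (T.map (algebraMap ℝ ℂ)).mulVec v = l • v) : ‖l‖ ≤ τ := by
  obtain ⟨P, hP, hτ⟩ := h
  have hPT : P * T = P := by
    have h1 : Tendsto (fun t : ℕ => T ^ (t + 1)) atTop (𝓝 P) := hP.comp (tendsto_add_atTop_nat 1)
    have h2 : Tendsto (fun t : ℕ => T ^ t * T) atTop (𝓝 (P * T)) := hP.mul_const T
    simp_rw [← pow_succ] at h2
    exact tendsto_nhds_unique h2 h1
  have hmul : ∀ M N : Matrix ι ι ℝ, (M * N).map (algebraMap ℝ ℂ) =
      M.map (algebraMap ℝ ℂ) * N.map (algebraMap ℝ ℂ) :=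
    fun M N => map_mul (algebraMap ℝ ℂ).mapMatrix M N
  have hPv : (P.map (algebraMap ℝ ℂ)).mulVec v = 0 := by
    have h1 : (P.map (algebraMap ℝ ℂ)).mulVec v = l • (P.map (algebraMap ℝ ℂ)).mulVec v := by
      conv_lhs => rw [← hPT, hmul, ← Matrix.mulVec_mulVec, hv, Matrix.mulVec_smul]
    have h2 : (1 - l) • (P.map (algebraMap ℝ ℂ)).mulVec v = 0 := by
      rw [sub_smul, one_smul, ← h1, sub_self]
    exact (smul_eq_zero.1 h2).resolve_left (sub_ne_zero.2 hl.symm)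
  have hTv : ∀ t : ℕ, ((T ^ t).map (algebraMap ℝ ℂ)).mulVec v = l ^ t • v := by
    intro t
    induction t with
    | zero =>
      simp
    | succ t ih =>
      rw [pow_succ, hmul, ← Matrix.mulVec_mulVec, hv, Matrix.mulVec_smul, ih, smul_smul, pow_succ,
        mul_comm]
  obtain ⟨c, C, hc, hC, hcC⟩ := exists_norm_complexCLM_equiv (ι := ι)
  have hle : ∀ t : ℕ, ‖l‖ ^ t ≤ ‖complexCLM (T ^ t - P)‖ := by
    intro t
    have hw : (0 : ℝ) < ‖WithLp.toLp 2 v‖ := by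
      rw [norm_pos_iff]
      intro h0
      exact hv0 (by simpa using congrArg WithLp.ofLp h0)
    have h1 := (complexCLM (T ^ t - P)).le_opNorm (WithLp.toLp 2 v)
    have h2 : complexCLM (T ^ t - P) (WithLp.toLp 2 v) = l ^ t • WithLp.toLp 2 v := by
      rw [map_sub, sub_apply, complexCLM_apply, complexCLM_apply,
        Matrix.toEuclideanCLM_toLp, Matrix.toEuclideanCLM_toLp, hTv, hPv]
      simp
    rw [h2, norm_smul, norm_pow] at h1
    exact le_of_mul_le_mul_right h1 hw
  have hlim : Tendsto (fun t : ℕ => ‖complexCLM (T ^ t - P)‖ ^ ((1 : ℝ) / (t : ℝ))) atTop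
      (𝓝 τ) := by
    refine tendsto_rpow_one_div_of_le (inv_pos.2 hC) (inv_pos.2 hc) (fun _ => norm_nonneg _)
      (fun t => ?_) (fun t => ?_) hτ
    · rw [inv_mul_le_iff₀ hC]; exact (hcC _).2
    · rw [le_inv_mul_iff₀ hc]; exact (hcC _).1
  refine ge_of_tendsto hlim ?_
  filter_upwards [eventually_ge_atTop 1] with t ht
  have h3 := Real.rpow_le_rpow (by positivity) (hle t) (show (0 : ℝ) ≤ 1 / (t : ℝ) by positivity)
  rwa [one_div, Real.pow_rpow_inv_natCast (norm_nonneg _) (by omega), ← one_div] at h3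

/-- The matrix all of whose entries are `1 / n`. -/
def avgMatrix (ι : Type*) [Fintype ι] : Matrix ι ι ℝ :=
  Matrix.of fun _ _ => (Fintype.card ι : ℝ)⁻¹

/-- With unit row and column sums, the averaging matrix `P` satisfies `TP = PT = PP = P`. The error
`T ^ t - P` is thus a power of `T - P`, whose spectral radius is `τ`, and Gelfand's formula gives
the rate; `τ < 1` gives convergence. Entries need not be nonnegative. -/
theorem hasRate_of_stochastic [Nonempty ι] {T : Matrix ι ι ℝ} {τ : ℝ} (hτ : τ < 1)
    (hrow : ∀ i, ∑ j, T i j = 1) (hcol : ∀ j, ∑ i, T i j = 1)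
    (hv : ∃ (l : ℂ) (v : ι → ℂ), l ≠ 1 ∧ ‖l‖ = τ ∧ v ≠ 0 ∧
      (T.map (algebraMap ℝ ℂ)).mulVec v = l • v)
    (hmax : ∀ (l : ℂ) (v : ι → ℂ), v ≠ 0 → ∑ i, v i = 0 →
      (T.map (algebraMap ℝ ℂ)).mulVec v = l • v → ‖l‖ ≤ τ) :
    HasRate T τ := by
  have hn : (Fintype.card ι : ℝ) ≠ 0 := by simp
  set P := avgMatrix ι with hPdef
  have hTP : T * P = P := by
    ext i j; simp [Matrix.mul_apply, hPdef, avgMatrix, ← Finset.sum_mul, hrow]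
  have hPT : P * T = P := by
    ext i j; simp [Matrix.mul_apply, hPdef, avgMatrix, ← Finset.mul_sum, hcol]
  have hPP : P * P = P := by
    ext i j; simp [Matrix.mul_apply, hPdef, avgMatrix, hn]
  -- Exponent `0` must be left out: there the left side would be `1` and the right side `1 - P`.
  have hpow : ∀ t : ℕ, (T - P) ^ (t + 1) = T ^ (t + 1) - P := by
    intro t
    have hTtP : ∀ t : ℕ, T ^ t * P = P := by
      intro t
      induction t with
      | zero => simp
      | succ t ih => rw [pow_succ, mul_assoc, hTP, ih]
    induction t with
    | zero => simp
    | succ t ih =>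
      rw [pow_succ, ih, sub_mul, mul_sub, mul_sub, hTtP, hPT, hPP, ← pow_succ]; abel
  have hPmul : ∀ v : ι → ℂ, (P.map (algebraMap ℝ ℂ)).mulVec v =
      fun _ => (Fintype.card ι : ℂ)⁻¹ * ∑ i, v i := by
    intro v; ext i
    simp [Matrix.mulVec, dotProduct, hPdef, avgMatrix, Finset.mul_sum]
  have hcolC : ∀ v : ι → ℂ, ∑ i, (T.map (algebraMap ℝ ℂ)).mulVec v i = ∑ i, v i := by
    intro v
    simp only [Matrix.mulVec, dotProduct, Matrix.map_apply]
    rw [Finset.sum_comm]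
    simp_rw [← Finset.sum_mul]
    refine Finset.sum_congr rfl fun j _ => ?_
    rw [← map_sum, hcol, map_one, one_mul]
  have hsub : (T - P).map (algebraMap ℝ ℂ) = T.map (algebraMap ℝ ℂ) - P.map (algebraMap ℝ ℂ) :=
    map_sub (algebraMap ℝ ℂ).mapMatrix T P
  have hsum : ∀ (l : ℂ) (v : ι → ℂ), l ≠ 1 → (T.map (algebraMap ℝ ℂ)).mulVec v = l • v →
      ∑ i, v i = 0 := by
    intro l v hl hlv
    have h1 := hcolC v
    rw [hlv] at h1
    simp only [Pi.smul_apply, smul_eq_mul, ← Finset.mul_sum] at h1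
    have h2 : (l - 1) * ∑ i, v i = 0 := by rw [sub_mul, h1]; ring
    exact (mul_eq_zero.1 h2).resolve_left (sub_ne_zero.2 hl)
  have hspec : spectrum ℂ (complexCLM (T - P)) = spectrum ℂ ((T - P).map (algebraMap ℝ ℂ)) :=
    AlgEquiv.spectrum_eq (Matrix.toEuclideanCLM (n := ι) (𝕜 := ℂ)) _
  obtain ⟨l, v, hl, hlτ, hv0, hlv⟩ := hv
  have hrad : spectralRadius ℂ (complexCLM (T - P)) = (‖l‖₊ : ENNReal) := by
    rw [spectralRadius, hspec]
    refine le_antisymm (iSup₂_le fun μ hμ => ?_) ?_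
    · obtain ⟨w, hw0, hw⟩ := mem_spectrum_iff_exists_mulVec.1 hμ
      rw [ENNReal.coe_le_coe, ← NNReal.coe_le_coe, coe_nnnorm, coe_nnnorm, hlτ]
      -- The columns of `T - P` sum to zero, so an eigenvector with `μ ≠ 0` has sum zero and is also
      -- an eigenvector of `T`.
      by_cases hμ0 : μ = 0
      · rw [hμ0, norm_zero, ← hlτ]; exact norm_nonneg _
      rw [hsub, Matrix.sub_mulVec, hPmul] at hw
      have hws : ∑ i, w i = 0 := by
        have h1 : ∑ i, ((T.map (algebraMap ℝ ℂ)).mulVec w -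
            fun _ : ι => (Fintype.card ι : ℂ)⁻¹ * ∑ i, w i) i = ∑ i, (μ • w) i := by rw [hw]
        simp only [Pi.sub_apply, Finset.sum_sub_distrib, hcolC, Finset.sum_const,
          Finset.card_univ, nsmul_eq_mul, Pi.smul_apply, smul_eq_mul, ← Finset.mul_sum] at h1
        rw [mul_inv_cancel_left₀ (by exact_mod_cast hn), sub_self] at h1
        exact (mul_eq_zero.1 h1.symm).resolve_left hμ0
      refine hmax μ w hw0 hws ?_
      rw [← hw, hws]
      ext i; simp
    · refine le_iSup₂_of_le l ?_ le_rfl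
      refine mem_spectrum_iff_exists_mulVec.2 ⟨v, hv0, ?_⟩
      rw [hsub, Matrix.sub_mulVec, hPmul, hsum l v hl hlv, hlv]
      ext i; simp
  have hgel : Tendsto (fun t : ℕ => ‖complexCLM ((T - P) ^ t)‖ ^ ((1 : ℝ) / (t : ℝ))) atTop
      (𝓝 τ) := by
    have h1 := spectrum.pow_norm_pow_one_div_tendsto_nhds_spectralRadius (complexCLM (T - P))
    rw [hrad] at h1
    have h2 := (ENNReal.tendsto_toReal ENNReal.coe_ne_top).comp h1
    rw [ENNReal.coe_toReal, coe_nnnorm, hlτ] at h2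
    refine h2.congr fun t => ?_
    simp only [Function.comp_apply]
    rw [ENNReal.toReal_ofReal (by positivity), complexCLM_pow]
  obtain ⟨c, C, hc, hC, hcC⟩ := exists_norm_complexCLM_equiv (ι := ι)
  have hreal : Tendsto (fun t : ℕ => ‖Matrix.toEuclideanCLM (𝕜 := ℝ) ((T - P) ^ t)‖ ^
      ((1 : ℝ) / (t : ℝ))) atTop (𝓝 τ) :=
    tendsto_rpow_one_div_of_le hc hC (fun _ => norm_nonneg _) (fun t => (hcC _).1)
      (fun t => (hcC _).2) hgel
  have hev : ∀ᶠ t : ℕ in atTop, (T - P) ^ t = T ^ t - P := by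
    filter_upwards [eventually_ge_atTop 1] with t ht
    obtain ⟨k, rfl⟩ : ∃ k, t = k + 1 := ⟨t - 1, by omega⟩
    exact hpow k
  refine ⟨P, ?_, hreal.congr' ?_⟩
  · have hzero : Tendsto (fun t : ℕ => ‖Matrix.toEuclideanCLM (𝕜 := ℝ) ((T - P) ^ t)‖) atTop
        (𝓝 0) := by
      have hτ0 : 0 ≤ τ := hlτ ▸ norm_nonneg l
      obtain ⟨q, hq1, hq2⟩ := exists_between hτ
      refine squeeze_zero' (Eventually.of_forall fun _ => norm_nonneg _) ?_
        (tendsto_pow_atTop_nhds_zero_of_lt_one (hτ0.trans hq1.le) hq2)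
      filter_upwards [hreal.eventually_lt_const hq1, eventually_ge_atTop 1] with t ht ht1
      have h1 := pow_le_pow_left₀ (Real.rpow_nonneg (norm_nonneg _) _) ht.le t
      rwa [one_div, Real.rpow_inv_natCast_pow (norm_nonneg _) (by omega)] at h1
    have h0 : Tendsto (fun t : ℕ => (T - P) ^ t) atTop (𝓝 0) := by
      let e : Matrix ι ι ℝ ≃ₗ[ℝ] (EuclideanSpace ℝ ι →L[ℝ] EuclideanSpace ℝ ι) :=
        (Matrix.toEuclideanCLM (n := ι) (𝕜 := ℝ)).toAlgEquiv.toLinearEquiv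
      have : FiniteDimensional ℝ (EuclideanSpace ℝ ι →L[ℝ] EuclideanSpace ℝ ι) :=
        e.finiteDimensional
      have h1 := (e.symm.toLinearMap.continuous_of_finiteDimensional.tendsto 0).comp
        (tendsto_zero_iff_norm_tendsto_zero.2 hzero)
      rw [map_zero] at h1
      refine h1.congr fun t => ?_
      exact e.symm_apply_apply _
    have h2 := h0.add_const P
    rw [zero_add] at h2
    refine h2.congr' ?_
    filter_upwards [hev] with t ht
    rw [ht, sub_add_cancel]
  · filter_upwards [hev] with t ht
    rw [ht]

end Complex

/-! ### Extremal eigenvalues of symmetric matrices on a hyperplane -/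

open scoped InnerProductSpace in
theorem exists_max_eigenvalue_of_invariant {E : Type*} [NormedAddCommGroup E]
    [InnerProductSpace ℝ E] [FiniteDimensional ℝ E] {T : E →ₗ[ℝ] E} (hT : T.IsSymmetric)
    {U : Submodule ℝ E} (hU : ∀ x ∈ U, T x ∈ U) [Nontrivial U] :
    ∃ (l : ℝ) (x : E), x ≠ 0 ∧ x ∈ U ∧ T x = l • x ∧ ∀ y ∈ U, ⟪T y, y⟫_ℝ ≤ l * ⟪y, y⟫_ℝ := by
  have hS : (T.restrict hU).IsSymmetric := hT.restrict_invariant hU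
  have hev := hS.hasEigenvalue_iSup_of_finiteDimensional
  obtain ⟨x, hx⟩ := hev.exists_hasEigenvector
  refine ⟨_, x, fun h => hx.2 (Subtype.ext h), x.2, congrArg Subtype.val hx.apply_eq_smul,
    fun y hy => ?_⟩
  by_cases hy0 : y = 0
  · simp [hy0]
  have hbdd : BddAbove (Set.range fun z : {z : U // z ≠ 0} =>
      RCLike.re ⟪(T.restrict hU) z, z⟫_ℝ / ‖(z : U)‖ ^ 2) := by
    refine ⟨‖(T.restrict hU).toContinuousLinearMap‖, ?_⟩
    rintro _ ⟨z, rfl⟩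
    have hz : 0 < ‖(z : U)‖ := norm_pos_iff.2 z.2
    simp only [RCLike.re_to_real]
    rw [div_le_iff₀ (by positivity)]
    refine (real_inner_le_norm _ _).trans ?_
    have := (T.restrict hU).toContinuousLinearMap.le_opNorm z
    rw [pow_two, ← mul_assoc]
    exact mul_le_mul_of_nonneg_right this hz.le
  have h1 := le_ciSup hbdd ⟨⟨y, hy⟩, fun h => hy0 (congrArg Subtype.val h)⟩
  simp only [RCLike.re_to_real] at h1
  have hz : (0 : ℝ) < ‖(⟨y, hy⟩ : U)‖ ^ 2 := by
    rw [sq_pos_iff, norm_ne_zero_iff]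
    exact fun h => hy0 (congrArg Subtype.val h)
  rw [div_le_iff₀ hz] at h1
  rw [real_inner_self_eq_norm_sq]
  exact h1

section

variable {ι : Type*} [Fintype ι] [DecidableEq ι]

/-- By symmetry the orthogonal complement of an eigenvector is invariant; it is nonzero because
there are at least two indices. -/
theorem exists_max_eigenvalue_orthogonal [Nontrivial ι] {M : Matrix ι ι ℝ} (hM : M.IsSymm)
    {u : ι → ℝ} {θ : ℝ} (hu : M.mulVec u = θ • u) :
    ∃ (l : ℝ) (x : ι → ℝ), x ≠ 0 ∧ u ⬝ᵥ x = 0 ∧ M.mulVec x = l • x ∧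
      ∀ y, u ⬝ᵥ y = 0 → y ⬝ᵥ M.mulVec y ≤ l * (y ⬝ᵥ y) := by
  have hT : (Matrix.toEuclideanLin M).IsSymmetric := by
    rw [Matrix.isSymmetric_toEuclideanLin_iff, Matrix.IsHermitian, Matrix.conjTranspose_eq_transpose_of_trivial]
    exact hM
  let w : EuclideanSpace ℝ ι := WithLp.toLp 2 u
  let U : Submodule ℝ (EuclideanSpace ℝ ι) := (ℝ ∙ w)ᗮ
  have hmem : ∀ y : ι → ℝ, WithLp.toLp 2 y ∈ U ↔ u ⬝ᵥ y = 0 := by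
    intro y
    rw [Submodule.mem_orthogonal_singleton_iff_inner_right, EuclideanSpace.inner_eq_star_dotProduct]
    simp only [star_trivial]
    rw [dotProduct_comm]
  have hU : ∀ x ∈ U, Matrix.toEuclideanLin M x ∈ U := by
    intro x hx
    obtain ⟨x, rfl⟩ := (WithLp.equiv 2 _).symm.surjective x
    change WithLp.toLp 2 (M.mulVec x) ∈ U
    rw [hmem, Matrix.dotProduct_mulVec, ← Matrix.mulVec_transpose, hM.eq, hu, smul_dotProduct,
      (hmem x).1 hx, smul_zero]
  have : Nontrivial U := by
    apply Module.nontrivial_of_finrank_pos (R := ℝ)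
    have h1 := Submodule.finrank_add_finrank_orthogonal (ℝ ∙ w)
    have h2 : Module.finrank ℝ (ℝ ∙ w) ≤ 1 :=
      finrank_span_le_card _ |>.trans (by simp)
    have h3 : 1 < Fintype.card ι := Fintype.one_lt_card
    rw [finrank_euclideanSpace] at h1
    change 0 < Module.finrank ℝ (ℝ ∙ w)ᗮ
    omega
  obtain ⟨l, x, hx0, hxU, hx, hmax⟩ := exists_max_eigenvalue_of_invariant hT hU
  obtain ⟨x, rfl⟩ := (WithLp.equiv 2 _).symm.surjective x
  refine ⟨l, x, fun h => hx0 (by rw [h]; rfl), (hmem x).1 hxU, congrArg WithLp.ofLp hx,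
    fun y hy => ?_⟩
  have := hmax (WithLp.toLp 2 y) ((hmem y).2 hy)
  rw [EuclideanSpace.inner_eq_star_dotProduct, EuclideanSpace.inner_eq_star_dotProduct] at this
  simpa using this

/-- The largest eigenvalue of a symmetric matrix relative to a positive diagonal matrix, on the
orthogonal complement of a given eigenvector. -/
theorem exists_max_generalized_eigenvalue [Nontrivial ι] {M : Matrix ι ι ℝ} (hM : M.IsSymm)
    {d : ι → ℝ} (hd : ∀ i, 0 < d i) {u : ι → ℝ} {θ : ℝ} (hu : M.mulVec u = θ • (d * u)) :
    ∃ (l : ℝ) (x : ι → ℝ), x ≠ 0 ∧ (d * u) ⬝ᵥ x = 0 ∧ M.mulVec x = l • (d * x) ∧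
      ∀ y, (d * u) ⬝ᵥ y = 0 → y ⬝ᵥ M.mulVec y ≤ l * (y ⬝ᵥ (d * y)) := by
  -- Conjugating by the square root of the diagonal turns the generalized problem into the ordinary
  -- one for the symmetric matrix `D^(-1/2) M D^(-1/2)`.
  set q : ι → ℝ := fun i => √(d i) with hq
  have hq0 : ∀ i, q i ≠ 0 := fun i => (Real.sqrt_pos.2 (hd i)).ne'
  have hqq : ∀ i, q i * q i = d i := fun i => Real.mul_self_sqrt (hd i).le
  let N : Matrix ι ι ℝ := Matrix.of fun i j => (q i)⁻¹ * M i j * (q j)⁻¹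
  have hN : N.IsSymm := by
    ext i j
    simp only [Matrix.transpose_apply, N, Matrix.of_apply, hM.apply]
    ring
  have hNv : ∀ (v : ι → ℝ) i, N.mulVec (q * v) i = (q i)⁻¹ * M.mulVec v i := by
    intro v i
    simp only [Matrix.mulVec, dotProduct, N, Matrix.of_apply, Pi.mul_apply, Finset.mul_sum]
    refine Finset.sum_congr rfl fun j _ => ?_
    have := hq0 j
    field_simp
  have hqv : ∀ v : ι → ℝ, q * (q⁻¹ * v) = v := by
    intro v; ext i; simp [mul_inv_cancel_left₀ (hq0 i)]
  have hNu : N.mulVec (q * u) = θ • (q * u) := by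
    ext i
    rw [hNv, hu]
    simp only [Pi.smul_apply, Pi.mul_apply, smul_eq_mul, ← hqq]
    have := hq0 i
    field_simp
  obtain ⟨l, x, hx0, hxu, hx, hmax⟩ := exists_max_eigenvalue_orthogonal hN hNu
  have hdot : ∀ y z : ι → ℝ, (d * y) ⬝ᵥ z = (q * y) ⬝ᵥ (q * z) := by
    intro y z
    simp only [dotProduct, Pi.mul_apply, ← hqq]
    exact Finset.sum_congr rfl fun i _ => by ring
  refine ⟨l, q⁻¹ * x, ?_, ?_, ?_, fun y hy => ?_⟩
  · intro h; apply hx0; rw [← hqv x, h, mul_zero]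
  · rw [hdot, hqv, hxu]
  · ext i
    have h1 := congrFun hx i
    rw [← hqv x, hNv, hqv, inv_mul_eq_iff_eq_mul₀ (hq0 i)] at h1
    rw [h1]
    simp only [Pi.smul_apply, Pi.mul_apply, smul_eq_mul, ← hqq, Pi.inv_apply]
    have := hq0 i
    field_simp
  · have h1 := hmax (q * y) (by rw [← hdot, hy])
    rw [← hdot, dotProduct_comm (d * y)] at h1
    refine le_of_eq_of_le ?_ h1
    simp only [dotProduct, hNv, Pi.mul_apply]
    refine Finset.sum_congr rfl fun i _ => ?_
    have := hq0 i
    field_simp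

end

/-- Eigenvalues of a symmetric real matrix relative to a positive diagonal matrix are real, with
real eigenvectors. -/
theorem exists_real_eigenvector {ι : Type*} [Fintype ι] {M : Matrix ι ι ℝ} (hM : M.IsSymm)
    {d : ι → ℝ} (hd : ∀ i, 0 < d i) {l : ℂ} {v : ι → ℂ} (hv0 : v ≠ 0)
    (hv : ∀ i, ∑ j, (M i j : ℂ) * v j = l * (d i * v i)) :
    ∃ (ω : ℝ) (x : ι → ℝ), l = ω ∧ x ≠ 0 ∧ M.mulVec x = ω • (d * x) ∧
      (x = (fun i => (v i).re) ∨ x = fun i => (v i).im) := by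
  have hpos : (0 : ℝ) < ∑ i, d i * Complex.normSq (v i) := by
    obtain ⟨i, hi⟩ := Function.ne_iff.1 hv0
    exact Finset.sum_pos' (fun j _ => mul_nonneg (hd j).le (Complex.normSq_nonneg _))
      ⟨i, Finset.mem_univ _, mul_pos (hd i) (Complex.normSq_pos.2 hi)⟩
  -- The form `v* M v` is real by symmetry and equals `l` times the positive number `∑ d |v|²`, so
  -- `l` is real.
  set a : ℂ := ∑ i, ∑ j, star (v i) * ((M i j : ℂ) * v j) with ha
  have h1 : a = l * ((∑ i, d i * Complex.normSq (v i) : ℝ) : ℂ) := by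
    rw [ha]
    push_cast
    rw [Finset.mul_sum]
    refine Finset.sum_congr rfl fun i _ => ?_
    rw [← Finset.mul_sum, hv, Complex.normSq_eq_conj_mul_self, Complex.star_def]
    ring
  have h2 : star a = a := by
    rw [ha, star_sum]
    simp_rw [star_sum]
    rw [Finset.sum_comm]
    refine Finset.sum_congr rfl fun i _ => Finset.sum_congr rfl fun j _ => ?_
    rw [← hM.apply i j]
    simp
    ring
  have h3 : l = (l.re : ℂ) := by
    rw [h1, star_mul', Complex.star_def, Complex.conj_ofReal] at h2
    have h4 := mul_right_cancel₀ (by exact_mod_cast hpos.ne') h2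
    exact (Complex.conj_eq_iff_re.1 h4).symm
  have hre : M.mulVec (fun i => (v i).re) = l.re • (d * fun i => (v i).re) := by
    ext i
    have := congrArg Complex.re (hv i)
    rw [h3, Complex.re_sum] at this
    simpa [Matrix.mulVec, dotProduct] using this
  have him : M.mulVec (fun i => (v i).im) = l.re • (d * fun i => (v i).im) := by
    ext i
    have := congrArg Complex.im (hv i)
    rw [h3, Complex.im_sum] at this
    simpa [Matrix.mulVec, dotProduct] using this
  -- Choosing the real or the imaginary part of `v` itself preserves real linear constraints on `v`,
  -- such as having sum zero.
  by_cases hz : (fun i => (v i).re) = 0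
  · refine ⟨l.re, _, h3, fun hz' => hv0 ?_, him, Or.inr rfl⟩
    ext i
    exact Complex.ext (congrFun hz i) (congrFun hz' i)
  · exact ⟨l.re, _, h3, hz, hre, Or.inl rfl⟩

theorem dotProduct_self_pos_of_pos {ι : Type*} [Fintype ι] {d x : ι → ℝ} (hd : ∀ i, 0 < d i)
    (hx : x ≠ 0) : 0 < x ⬝ᵥ (d * x) := by
  obtain ⟨i, hi⟩ := Function.ne_iff.1 hx
  refine Finset.sum_pos' (fun j _ => ?_) ⟨i, Finset.mem_univ _, ?_⟩
  · have := mul_nonneg (hd j).le (mul_self_nonneg (x j))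
    simp only [Pi.mul_apply]; linarith
  · have := mul_pos (hd i) (mul_self_pos.2 hi)
    simp only [Pi.mul_apply]; linarith

/-! ### Spectral gap and conductance -/

section Graph

variable {V : Type*} [Fintype V] (G : SimpleGraph V) [DecidableRel G.Adj]

/-- The degrees of the nodes, as real numbers. -/
def deg : V → ℝ := fun i => (G.degree i : ℝ)

variable {G}

theorem deg_pos [Nontrivial V] (hG : G.Connected) (i : V) : 0 < deg G i :=
  Nat.cast_pos.2 (hG.preconnected.degree_pos_of_nontrivial i)

theorem adjMatrix_mulVec_one : (G.adjMatrix ℝ).mulVec 1 = deg G := by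
  ext i
  rw [SimpleGraph.adjMatrix_mulVec_apply]
  simp [deg]

theorem orthogonal_of_eigenvector {x : V → ℝ} {ω : ℝ}
    (hx : (G.adjMatrix ℝ).mulVec x = ω • (deg G * x)) (hω : ω ≠ 1) : deg G ⬝ᵥ x = 0 := by
  have h1 : deg G ⬝ᵥ x = ω * (deg G ⬝ᵥ x) := by
    conv_lhs => rw [← adjMatrix_mulVec_one, dotProduct_comm, Matrix.dotProduct_mulVec,
      ← Matrix.mulVec_transpose, (G.isSymm_adjMatrix).eq, hx]
    simp [dotProduct, Finset.mul_sum]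
  have h2 : (1 - ω) * (deg G ⬝ᵥ x) = 0 := by rw [sub_mul, one_mul, ← h1, sub_self]
  exact (mul_eq_zero.1 h2).resolve_left (sub_ne_zero.2 hω.symm)

/-- Maximum principle: compare both sides at a node where `|x|` is largest. -/
theorem abs_eigenvalue_le_one [Nontrivial V] (hG : G.Connected) {x : V → ℝ} {ω : ℝ} (hx0 : x ≠ 0)
    (hx : (G.adjMatrix ℝ).mulVec x = ω • (deg G * x)) : |ω| ≤ 1 := by
  obtain ⟨i, -, hi⟩ := Finset.exists_max_image Finset.univ (fun i => |x i|)
    Finset.univ_nonempty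
  obtain ⟨j, hj⟩ := Function.ne_iff.1 hx0
  have hpos : 0 < |x i| := (abs_pos.2 hj).trans_le (hi j (Finset.mem_univ _))
  have h1 := congrFun hx i
  rw [SimpleGraph.adjMatrix_mulVec_apply] at h1
  have h2 : |∑ j ∈ G.neighborFinset i, x j| ≤ deg G i * |x i| := by
    refine (Finset.abs_sum_le_sum_abs _ _).trans ?_
    refine (Finset.sum_le_card_nsmul _ _ _ fun j _ => hi j (Finset.mem_univ _)).trans ?_
    rw [SimpleGraph.card_neighborFinset_eq_degree, nsmul_eq_mul]
    rfl
  rw [h1] at h2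
  simp only [Pi.smul_apply, Pi.mul_apply, smul_eq_mul, abs_mul, abs_of_pos (deg_pos hG i)] at h2
  have h3 : 0 < deg G i * |x i| := mul_pos (deg_pos hG i) hpos
  nlinarith

variable [DecidableEq V]

theorem lapMatrix_mulVec_eq (x : V → ℝ) :
    (G.lapMatrix ℝ).mulVec x = deg G * x - (G.adjMatrix ℝ).mulVec x := by
  ext i
  rw [SimpleGraph.lapMatrix_mulVec_apply, Pi.sub_apply, SimpleGraph.adjMatrix_mulVec_apply]
  rfl

theorem dotProduct_lapMatrix_mulVec (x : V → ℝ) : x ⬝ᵥ (G.lapMatrix ℝ).mulVec x =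
    (∑ i : V, ∑ j : V, if G.Adj i j then (x i - x j) ^ 2 else 0) / 2 := by
  rw [← SimpleGraph.lapMatrix_toLinearMap₂', Matrix.toLinearMap₂'_apply']

theorem walkMatrix_mulVec [Nontrivial V] (hG : G.Connected) (x : V → ℝ) (i : V) :
    (walkMatrix G).mulVec x i = (deg G i)⁻¹ * (G.adjMatrix ℝ).mulVec x i := by
  have h : (G.degMatrix ℝ)⁻¹ = Matrix.diagonal fun i => (deg G i)⁻¹ := by
    refine Matrix.inv_eq_right_inv ?_
    rw [SimpleGraph.degMatrix, Matrix.diagonal_mul_diagonal, ← Matrix.diagonal_one]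
    congr 1
    ext i
    exact mul_inv_cancel₀ (deg_pos hG i).ne'
  rw [walkMatrix, h, ← Matrix.mulVec_mulVec, Matrix.mulVec_diagonal]

theorem walkMatrix_mulVec_eq_smul_iff [Nontrivial V] (hG : G.Connected) {x : V → ℝ} {ω : ℝ} :
    (walkMatrix G).mulVec x = ω • x ↔ (G.adjMatrix ℝ).mulVec x = ω • (deg G * x) := by
  rw [funext_iff, funext_iff]
  refine forall_congr' fun i => ?_
  rw [walkMatrix_mulVec hG, inv_mul_eq_iff_eq_mul₀ (deg_pos hG i).ne']
  simp only [Pi.smul_apply, Pi.mul_apply, smul_eq_mul]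
  rw [mul_left_comm]

theorem eq_const_of_adjMatrix_mulVec (hG : G.Connected) {x : V → ℝ}
    (hx : (G.adjMatrix ℝ).mulVec x = deg G * x) (i j : V) : x i = x j := by
  have h : (G.lapMatrix ℝ).mulVec x = 0 := by rw [lapMatrix_mulVec_eq, hx, sub_self]
  exact SimpleGraph.lapMatrix_mulVec_eq_zero_iff_forall_reachable G |>.1 h i j (hG.preconnected i j)

/-- This replaces the definition through roots of the characteristic polynomial by a Rayleigh
quotient. Connectedness makes `1` a simple eigenvalue of `W`, with the degrees as left eigenvector,
so the next root is the maximum of the quotient on the vectors orthogonal to the degrees. -/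
theorem omegaStar_spec [Nontrivial V] (hG : G.Connected) : omegaStar G < 1 ∧
    (∃ x : V → ℝ, x ≠ 0 ∧ deg G ⬝ᵥ x = 0 ∧
      (G.adjMatrix ℝ).mulVec x = omegaStar G • (deg G * x)) ∧
    ∀ y, deg G ⬝ᵥ y = 0 → y ⬝ᵥ (G.adjMatrix ℝ).mulVec y ≤ omegaStar G * (y ⬝ᵥ (deg G * y)) := by
  have hd := deg_pos hG
  obtain ⟨l, x, hx0, hxu, hx, hmax⟩ := exists_max_generalized_eigenvalue
    (G.isSymm_adjMatrix (α := ℝ)) hd (u := 1) (θ := 1)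
    (by rw [adjMatrix_mulVec_one, mul_one, one_smul])
  rw [mul_one] at hxu
  simp only [mul_one] at hmax
  have hl : l < 1 := by
    refine lt_of_le_of_ne ((le_abs_self l).trans (abs_eigenvalue_le_one hG hx0 hx)) ?_
    rintro rfl
    rw [one_smul] at hx
    have hc := eq_const_of_adjMatrix_mulVec hG hx
    obtain ⟨i, hi⟩ := Function.ne_iff.1 hx0
    have h1 : deg G ⬝ᵥ x = (∑ j, deg G j) * x i := by
      rw [dotProduct, Finset.sum_mul]
      exact Finset.sum_congr rfl fun j _ => by rw [hc j i]
    have h2 : 0 < ∑ j, deg G j := Finset.sum_pos (fun j _ => hd j) Finset.univ_nonempty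
    rw [h1] at hxu
    exact (mul_ne_zero h2.ne' hi) hxu
  have hω : omegaStar G = l := by
    refine secondEigenvalue_eq (μ := 1) ?_ hl
      ⟨x, hx0, (walkMatrix_mulVec_eq_smul_iff hG).2 hx⟩ ?_
    · refine count_roots_charpoly_eq_one (u := 1) (w := deg G) ?_ ?_ ?_ ?_
      · rw [walkMatrix_mulVec_eq_smul_iff hG, adjMatrix_mulVec_one, mul_one, one_smul]
      · have h1 : Matrix.vecMul (deg G) (G.degMatrix ℝ)⁻¹ = 1 := by
          have h2 : Matrix.vecMul 1 (G.degMatrix ℝ) = deg G := by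
            ext i
            rw [SimpleGraph.degMatrix, Matrix.vecMul_diagonal]
            simp [deg]
          have h3 : IsUnit (G.degMatrix ℝ).det := by
            rw [isUnit_iff_ne_zero, SimpleGraph.degMatrix, Matrix.det_diagonal]
            exact Finset.prod_ne_zero_iff.2 fun i _ => (hd i).ne'
          rw [← h2, Matrix.vecMul_vecMul, Matrix.mul_nonsing_inv _ h3, Matrix.vecMul_one]
        rw [walkMatrix, ← Matrix.vecMul_vecMul, h1, ← Matrix.mulVec_transpose,
          (G.isSymm_adjMatrix).eq, adjMatrix_mulVec_one, one_smul]
      · rw [dotProduct_one]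
        exact (Finset.sum_pos (fun j _ => hd j) Finset.univ_nonempty).ne'
      · intro v hv
        rw [walkMatrix_mulVec_eq_smul_iff hG, one_smul] at hv
        have hc := eq_const_of_adjMatrix_mulVec hG hv
        obtain ⟨i⟩ := hG.nonempty
        exact ⟨v i, by ext j; simp [hc j i]⟩
    · intro ω v hω1 hv0 hv
      rw [walkMatrix_mulVec_eq_smul_iff hG] at hv
      have h1 := hmax v (orthogonal_of_eigenvector hv hω1)
      rw [hv, dotProduct_smul, smul_eq_mul] at h1
      have h2 := dotProduct_self_pos_of_pos hd hv0
      exact le_of_mul_le_mul_right h1 h2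
  rw [hω]
  exact ⟨hl, ⟨x, hx0, hxu, hx⟩, hmax⟩

theorem eigenvalue_le_omegaStar [Nontrivial V] (hG : G.Connected) {x : V → ℝ} {ω : ℝ}
    (hx0 : x ≠ 0) (hx : (G.adjMatrix ℝ).mulVec x = ω • (deg G * x)) (hω1 : ω ≠ 1) :
    ω ≤ omegaStar G := by
  have h1 := (omegaStar_spec hG).2.2 x (orthogonal_of_eigenvector hx hω1)
  rw [hx, dotProduct_smul, smul_eq_mul] at h1
  have h2 := dotProduct_self_pos_of_pos (deg_pos hG) hx0
  exact le_of_mul_le_mul_right h1 h2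

theorem exists_cut_of_conductance_le [Nontrivial V] (hG : G.Connected) {c : ℝ}
    (h : conductance G ≤ c) : ∃ S : Finset V, 0 < vol G S ∧ vol G S ≤ G.edgeFinset.card ∧
      (cutValue G S : ℝ) ≤ c * vol G S := by
  set A := {r : ℝ | ∃ S : Finset V, 0 < vol G S ∧ vol G S ≤ G.edgeFinset.card ∧
    r = (cutValue G S : ℝ) / (vol G S : ℝ)} with hA
  have hfin : A.Finite := by
    refine (Set.finite_range fun S : Finset V => (cutValue G S : ℝ) / (vol G S : ℝ)).subset ?_
    rintro r ⟨S, -, -, rfl⟩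
    exact ⟨S, rfl⟩
  have hne : A.Nonempty := by
    obtain ⟨v⟩ := hG.nonempty
    -- A single node is admissible: its volume counts its incident edges, hence is positive and at
    -- most `|E|`.
    refine ⟨_, {v}, ?_, ?_, rfl⟩
    · simpa [vol] using hG.preconnected.degree_pos_of_nontrivial v
    · simp only [vol, Finset.sum_singleton]
      rw [← SimpleGraph.card_incidenceFinset_eq_degree]
      exact Finset.card_le_card (SimpleGraph.incidenceFinset_subset G v)
  obtain ⟨S, h1, h2, h3⟩ := hne.csInf_mem hfin
  refine ⟨S, h1, h2, ?_⟩
  have h4 : (cutValue G S : ℝ) / (vol G S : ℝ) ≤ c := h3 ▸ h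
  rwa [div_le_iff₀ (by exact_mod_cast h1)] at h4

/-- The test vector is the indicator of a set `S` of minimal conductance, shifted by `t =
vol(S)/(2|E|) ≤ 1/2` to be orthogonal to the degrees. Its Laplacian form is `cut(S) ≤ vol(S)/2` and
its weighted norm is `vol(S)(1 - t) ≥ vol(S)/2`, so `1 - ω⋆ ≤ 1`. -/
theorem omegaStar_nonneg [Nontrivial V] (hG : G.Connected) (h : conductance G ≤ 1 / 2) :
    0 ≤ omegaStar G := by
  obtain ⟨S, h1, h2, h3⟩ := exists_cut_of_conductance_le hG h
  have hvol : (vol G S : ℝ) = ∑ i ∈ S, deg G i := by simp [vol, deg]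
  have htot : ∑ i, deg G i = 2 * (G.edgeFinset.card : ℝ) := by
    have := G.sum_degrees_eq_twice_card_edges
    simp only [deg]
    exact_mod_cast this
  have h1' : (0 : ℝ) < vol G S := by exact_mod_cast h1
  have h2' : (vol G S : ℝ) ≤ G.edgeFinset.card := by exact_mod_cast h2
  set m : ℝ := (G.edgeFinset.card : ℝ) with hm
  have hm0 : 0 < m := h1'.trans_le h2'
  set s : ℝ := (vol G S : ℝ) with hs
  set ind : V → ℝ := fun i => if i ∈ S then 1 else 0 with hind
  set t : ℝ := s / (2 * m) with ht
  have hind1 : ∑ i, deg G i * ind i = s := by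
    rw [hvol]; simp [hind, Finset.sum_ite_mem]
  have hts : t * (2 * m) = s := by rw [ht]; field_simp
  have ht2 : t ≤ 1 / 2 := by rw [ht, div_le_div_iff₀ (by positivity) (by norm_num)]; linarith
  let y : V → ℝ := fun i => ind i - t
  have hy : deg G ⬝ᵥ y = 0 := by
    simp only [dotProduct, y, mul_sub, Finset.sum_sub_distrib, hind1, ← Finset.sum_mul, htot]
    linarith
  have hyy : y ⬝ᵥ (deg G * y) = s * (1 - t) := by
    have h4 : y ⬝ᵥ (deg G * y) = ∑ i, (deg G i * ind i) * (1 - 2 * t) + ∑ i, deg G i * t ^ 2 := by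
      rw [dotProduct, ← Finset.sum_add_distrib]
      refine Finset.sum_congr rfl fun i _ => ?_
      have h5 : ind i * ind i = ind i := by simp [hind]
      simp only [Pi.mul_apply, y]
      linear_combination deg G i * h5
    rw [h4, ← Finset.sum_mul, ← Finset.sum_mul, hind1, htot]
    linear_combination t * hts
  have hcut : y ⬝ᵥ (G.lapMatrix ℝ).mulVec y = cutValue G S := by
    have h4 : ∀ i j, (if G.Adj i j then (y i - y j) ^ 2 else 0) =
        (if i ∈ S ∧ j ∉ S ∧ G.Adj i j then (1 : ℝ) else 0) +
          if j ∈ S ∧ i ∉ S ∧ G.Adj j i then (1 : ℝ) else 0 := by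
      intro i j
      simp only [G.adj_comm j i]
      by_cases hi : i ∈ S <;> by_cases hj : j ∈ S <;> by_cases hij : G.Adj i j <;>
        simp [y, hind, hi, hj, hij]
      exact Or.inr (by ring)
    have h5 : (cutValue G S : ℝ) = ∑ i, ∑ j, if i ∈ S ∧ j ∉ S ∧ G.Adj i j then (1 : ℝ) else 0 := by
      rw [← Fintype.sum_prod_type' (f := fun i j => if i ∈ S ∧ j ∉ S ∧ G.Adj i j then (1 : ℝ)
        else 0), Finset.sum_boole, cutValue]
      congr 2
      ext ⟨i, j⟩
      simp [SimpleGraph.mem_interedges_iff]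
    rw [dotProduct_lapMatrix_mulVec]
    simp_rw [h4, Finset.sum_add_distrib]
    rw [Finset.sum_comm (f := fun i j => if j ∈ S ∧ i ∉ S ∧ G.Adj j i then (1 : ℝ) else 0), ← h5]
    ring
  have h4 := (omegaStar_spec hG).2.2 y hy
  rw [lapMatrix_mulVec_eq, dotProduct_sub, hyy] at hcut
  rw [hyy] at h4
  by_contra hneg
  push Not at hneg
  nlinarith [mul_pos h1' (show 0 < 1 - t by linarith)]

end Graph

/-! ### The spectrum of the ADMM iteration matrix -/

section Graph

variable {V : Type*} [DecidableEq V] {G : SimpleGraph V}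

/-- The alternating sum of the indicators of the edges of a walk. -/
def alternatingFlow : {u v : V} → G.Walk u v → G.Dart → ℂ
  | _, _, .nil => 0
  | _, _, .cons (u := a) (v := b) h p => fun e =>
      (if e = ⟨(a, b), h⟩ then 1 else 0) + (if e.symm = ⟨(a, b), h⟩ then 1 else 0) +
        (-1) * alternatingFlow p e

theorem alternatingFlow_symm {u v : V} (p : G.Walk u v) (e : G.Dart) :
    alternatingFlow p e.symm = alternatingFlow p e := by
  induction p with
  | nil => rfl
  | cons h p ih =>
    simp only [alternatingFlow, ih, SimpleGraph.Dart.symm_symm]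
    ring

theorem alternatingFlow_eq_zero {u v : V} (p : G.Walk u v) (e : G.Dart) (he : e.edge ∉ p.edges) :
    alternatingFlow p e = 0 := by
  induction p with
  | nil => rfl
  | @cons a b c h p ih =>
    rw [SimpleGraph.Walk.edges_cons, List.mem_cons, not_or] at he
    have h1 : e ≠ ⟨(a, b), h⟩ := by rintro rfl; exact he.1 rfl
    have h2 : e.symm ≠ ⟨(a, b), h⟩ := by
      intro h3
      apply he.1
      rw [← SimpleGraph.Dart.edge_symm, h3]; rfl
    simp [alternatingFlow, h1, h2, ih he.2]

/-- The permutation matrix of the reversal of darts. -/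
def flipMatrix (G : SimpleGraph V) : Matrix G.Dart G.Dart ℝ :=
  Matrix.of fun e e' => if e' = e.symm then 1 else 0

theorem flipMatrix_transpose : (flipMatrix G).transpose = flipMatrix G := by
  ext e e'
  simp only [flipMatrix, Matrix.transpose_apply, Matrix.of_apply]
  congr 1
  exact propext ⟨fun h => by rw [h, SimpleGraph.Dart.symm_symm],
    fun h => by rw [h, SimpleGraph.Dart.symm_symm]⟩

variable [Fintype V] [DecidableRel G.Adj]

theorem sum_darts_from (f : V → V → ℂ) (i : V) :
    (∑ e : G.Dart, if e.fst = i then f e.fst e.snd else 0) = ∑ j ∈ G.neighborFinset i, f i j := by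
  rw [← Finset.sum_filter, SimpleGraph.dart_fst_fiber,
    Finset.sum_image fun a _ b _ h => SimpleGraph.dartOfNeighborSet_injective G i h]
  exact Finset.sum_set_coe (G.neighborSet i) (f := f i)

/-- The average of a function of the darts over the darts that start at a given node. -/
def dartAvg (v : G.Dart → ℂ) (i : V) : ℂ :=
  (deg G i : ℂ)⁻¹ * ∑ e : G.Dart, if e.fst = i then v e else 0

theorem dartAvg_add (v w : G.Dart → ℂ) (i : V) :
    dartAvg (fun e => v e + w e) i = dartAvg v i + dartAvg w i := by
  simp only [dartAvg]
  rw [← mul_add, ← Finset.sum_add_distrib]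
  congr 1
  exact Finset.sum_congr rfl fun e _ => by split_ifs <;> simp

theorem dartAvg_mul (c : ℂ) (v : G.Dart → ℂ) (i : V) :
    dartAvg (fun e => c * v e) i = c * dartAvg v i := by
  simp only [dartAvg]
  rw [mul_left_comm c]
  congr 1
  rw [Finset.mul_sum]
  exact Finset.sum_congr rfl fun e _ => by split_ifs <;> simp

theorem dartAvg_snd (f : V → ℂ) (i : V) :
    dartAvg (fun e : G.Dart => f e.snd) i = (deg G i : ℂ)⁻¹ * ∑ j ∈ G.neighborFinset i, f j := by
  rw [dartAvg, sum_darts_from fun _ j => f j]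

theorem dartAvg_fst [Nontrivial V] (hG : G.Connected) (f : V → ℂ) (i : V) :
    dartAvg (fun e : G.Dart => f e.fst) i = f i := by
  have h := deg_pos hG i
  rw [dartAvg, sum_darts_from fun i _ => f i, Finset.sum_const,
    SimpleGraph.card_neighborFinset_eq_degree, nsmul_eq_mul]
  have h0 : (deg G i : ℂ) ≠ 0 := by exact_mod_cast h.ne'
  have h1 : ((G.degree i : ℕ) : ℂ) = (deg G i : ℂ) := by simp [deg]
  rw [h1, inv_mul_cancel_left₀ h0]

/-! ### Explicit action of `A`, `B` and `T_A` on messages -/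

theorem flipMatrix_mul_self : flipMatrix G * flipMatrix G = 1 := by
  ext e e'
  rw [Matrix.mul_apply, Finset.sum_eq_single e.symm]
  · simp [flipMatrix, Matrix.one_apply, eq_comm]
  · intro b _ hb
    simp [flipMatrix, hb]
  · simp

theorem matA_eq {ρ : ℝ} (hρ : 0 < ρ) :
    matA G ρ = ((ρ + 1) / (ρ + 2)) • (1 : Matrix G.Dart G.Dart ℝ) +
      (1 / (ρ + 2)) • flipMatrix G := by
  have hQ : matQ G = 1 - flipMatrix G := by
    ext e e'
    simp only [matQ, flipMatrix, Matrix.of_apply, Matrix.sub_apply, Matrix.one_apply,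
      eq_comm (a := e')]
    by_cases h : e = e'
    · subst h
      simp [SimpleGraph.Dart.symm_ne]
    · by_cases h2 : e.symm = e' <;> simp [h, h2]
  have h2 : ρ + 2 ≠ 0 := by positivity
  have h1 : ρ ≠ 0 := hρ.ne'
  refine Matrix.inv_eq_right_inv ?_
  have h3 : ∀ a b c d : ℝ, (a • (1 : Matrix G.Dart G.Dart ℝ) + b • flipMatrix G) *
      (c • 1 + d • flipMatrix G) = (a * c + b * d) • 1 + (a * d + b * c) • flipMatrix G := by
    intro a b c d
    simp only [add_mul, mul_add, smul_mul_smul_comm, mul_one, one_mul, flipMatrix_mul_self,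
      add_smul]
    abel
  have h4 : (1 : Matrix G.Dart G.Dart ℝ) + ρ⁻¹ • matQ G =
      (1 + ρ⁻¹) • (1 : Matrix G.Dart G.Dart ℝ) + (-ρ⁻¹) • flipMatrix G := by
    rw [hQ, smul_sub, add_smul, one_smul, neg_smul]; abel
  rw [h4, h3]
  have h5 : (1 + ρ⁻¹) * ((ρ + 1) / (ρ + 2)) + -ρ⁻¹ * (1 / (ρ + 2)) = 1 := by field_simp; ring
  have h6 : (1 + ρ⁻¹) * (1 / (ρ + 2)) + -ρ⁻¹ * ((ρ + 1) / (ρ + 2)) = 0 := by field_simp; ring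
  rw [h5, h6, one_smul, zero_smul, add_zero]

theorem matB_apply [Nontrivial V] (hG : G.Connected) (e e' : G.Dart) :
    matB G e e' = if e'.fst = e.fst then (deg G e.fst)⁻¹ else 0 := by
  have h1 : (incS G).transpose * incS G = Matrix.diagonal (deg G) := by
    ext i j
    simp only [incS, Matrix.mul_apply, Matrix.transpose_apply, Matrix.of_apply,
      Matrix.diagonal_apply, mul_ite, mul_one, mul_zero]
    by_cases h : i = j
    · subst h
      simp only [if_true]
      have h2 := G.dart_fst_fiber_card_eq_degree i
      rw [Finset.sum_congr rfl (g := fun e : G.Dart => if e.fst = i then (1 : ℝ) else 0)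
        fun e _ => by split_ifs <;> rfl, Finset.sum_boole, h2]
      rfl
    · rw [if_neg h]
      refine Finset.sum_eq_zero fun e _ => ?_
      by_cases h3 : e.fst = j
      · rw [if_pos h3, if_neg fun h4 => h (h4.symm.trans h3)]
      · rw [if_neg h3]
  have h2 : (Matrix.diagonal (deg G))⁻¹ = Matrix.diagonal fun i => (deg G i)⁻¹ := by
    refine Matrix.inv_eq_right_inv ?_
    rw [Matrix.diagonal_mul_diagonal, ← Matrix.diagonal_one]
    congr 1
    ext i
    exact mul_inv_cancel₀ (deg_pos hG i).ne'
  rw [matB, h1, h2, Matrix.mul_apply]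
  simp only [Matrix.mul_diagonal, Matrix.transpose_apply, incS, Matrix.of_apply]
  rw [Finset.sum_eq_single e.fst]
  · simp
  · intro i _ hi
    simp [hi.symm]
  · simp

theorem flipMatrix_mulVec_complex (v : G.Dart → ℂ) (e : G.Dart) :
    ((flipMatrix G).map (algebraMap ℝ ℂ)).mulVec v e = v e.symm := by
  rw [Matrix.mulVec, dotProduct, Finset.sum_eq_single e.symm]
  · simp [flipMatrix]
  · intro b _ hb
    simp [flipMatrix, hb]
  · simp

theorem matB_mulVec_complex [Nontrivial V] (hG : G.Connected) (v : G.Dart → ℂ) (e : G.Dart) :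
    ((matB G).map (algebraMap ℝ ℂ)).mulVec v e = dartAvg v e.fst := by
  simp only [Matrix.mulVec, dotProduct, Matrix.map_apply, matB_apply hG, dartAvg, Finset.mul_sum]
  refine Finset.sum_congr rfl fun e' _ => ?_
  split_ifs <;> simp

theorem matA_mulVec_complex {ρ : ℝ} (hρ : 0 < ρ) (v : G.Dart → ℂ) (e : G.Dart) :
    ((matA G ρ).map (algebraMap ℝ ℂ)).mulVec v e =
      (((ρ + 1) / (ρ + 2) : ℝ) : ℂ) * v e + ((1 / (ρ + 2) : ℝ) : ℂ) * v e.symm := by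
  have h1 : (matA G ρ).map (algebraMap ℝ ℂ) =
      (((ρ + 1) / (ρ + 2) : ℝ) : ℂ) • (1 : Matrix G.Dart G.Dart ℂ) +
        ((1 / (ρ + 2) : ℝ) : ℂ) • (flipMatrix G).map (algebraMap ℝ ℂ) := by
    rw [matA_eq hρ]
    ext e e'
    by_cases h : e = e' <;> simp [h]
  rw [h1, Matrix.add_mulVec, Matrix.smul_mulVec, Matrix.smul_mulVec, Matrix.one_mulVec,
    Pi.add_apply, Pi.smul_apply, Pi.smul_apply, flipMatrix_mulVec_complex, smul_eq_mul, smul_eq_mul]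

theorem admmMatrix_mulVec_complex [Nontrivial V] (hG : G.Connected) {γ ρ : ℝ} (hρ : 0 < ρ)
    (v : G.Dart → ℂ) (e : G.Dart) :
    ((admmMatrix G γ ρ).map (algebraMap ℝ ℂ)).mulVec v e =
      v e - γ * ((((ρ + 1) / (ρ + 2) : ℝ) : ℂ) * v e + ((1 / (ρ + 2) : ℝ) : ℂ) * v e.symm +
        dartAvg v e.fst - 2 * ((((ρ + 1) / (ρ + 2) : ℝ) : ℂ) * dartAvg v e.fst +
          ((1 / (ρ + 2) : ℝ) : ℂ) * dartAvg (fun e => v e.symm) e.fst)) := by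
  have hmul : (matB G * matA G ρ).map (algebraMap ℝ ℂ) =
      (matB G).map (algebraMap ℝ ℂ) * (matA G ρ).map (algebraMap ℝ ℂ) :=
    map_mul (algebraMap ℝ ℂ).mapMatrix _ _
  have h1 : (admmMatrix G γ ρ).map (algebraMap ℝ ℂ) =
      1 - (γ : ℂ) • ((matA G ρ).map (algebraMap ℝ ℂ) + (matB G).map (algebraMap ℝ ℂ) -
        (2 : ℂ) • ((matB G).map (algebraMap ℝ ℂ) * (matA G ρ).map (algebraMap ℝ ℂ))) := by
    rw [← hmul]
    ext e e'
    by_cases h : e = e' <;> simp [admmMatrix, h]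
  rw [h1, Matrix.sub_mulVec, Matrix.one_mulVec, Matrix.smul_mulVec, Matrix.sub_mulVec,
    Matrix.add_mulVec, Matrix.smul_mulVec, ← Matrix.mulVec_mulVec]
  simp only [Pi.sub_apply, Pi.add_apply, Pi.smul_apply, smul_eq_mul, matB_mulVec_complex hG,
    matA_mulVec_complex hρ]
  have h2 : ((matA G ρ).map (algebraMap ℝ ℂ)).mulVec v = fun e =>
      (((ρ + 1) / (ρ + 2) : ℝ) : ℂ) * v e + ((1 / (ρ + 2) : ℝ) : ℂ) * v e.symm :=
    funext (matA_mulVec_complex hρ v)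
  rw [h2, dartAvg_add, dartAvg_mul, dartAvg_mul]

/-- The eigenvalue equation of the operator `(2 B - I) (F + r I)` on the messages, where `F` is the
reversal of darts. -/
def IsMessageEigenvector (r : ℝ) (u : ℂ) (v : G.Dart → ℂ) : Prop :=
  ∀ e : G.Dart, 2 * (dartAvg (fun e => v e.symm) e.fst + r * dartAvg v e.fst) - v e.symm
    - r * v e = u * v e

/-- The eigenvalue equation of `T_A` in terms of the averages over the darts at a node. -/
theorem admmMatrix_mulVec_eq_smul_iff [Nontrivial V] (hG : G.Connected) {γ r : ℝ} (hγ : 0 < γ)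
    (hr : 0 < r) {u : ℂ} {v : G.Dart → ℂ} :
    ((admmMatrix G γ (2 * r)).map (algebraMap ℝ ℂ)).mulVec v =
        (1 - γ / 2 + γ / 2 * (u / (1 + r)) : ℂ) • v ↔ IsMessageEigenvector r u v := by
  rw [funext_iff, IsMessageEigenvector]
  refine forall_congr' fun e => ?_
  rw [admmMatrix_mulVec_complex hG (by positivity), Pi.smul_apply, smul_eq_mul]
  have h1 : (1 + r : ℂ) ≠ 0 := by exact_mod_cast (by positivity : (1 + r : ℝ) ≠ 0)
  have h2 : (γ : ℂ) ≠ 0 := by exact_mod_cast hγ.ne'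
  have h3 : (((2 * r + 1) / (2 * r + 2) : ℝ) : ℂ) = (2 * r + 1) / (2 * (1 + r)) := by
    push_cast; congr 1; ring
  have h4 : ((1 / (2 * r + 2) : ℝ) : ℂ) = 1 / (2 * (1 + r)) := by
    push_cast; congr 1; ring
  rw [h3, h4]
  set p := dartAvg v e.fst
  set q := dartAvg (fun e => v e.symm) e.fst
  -- This is `A + B - 2BA = (I - (2B - I)(2A - I))/2` together with `2A - I = (F + rI)/(1 + r)`.
  have key : (v e - γ * ((2 * r + 1) / (2 * (1 + r)) * v e + 1 / (2 * (1 + r)) * v e.symm + p -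
      2 * ((2 * r + 1) / (2 * (1 + r)) * p + 1 / (2 * (1 + r)) * q))) -
      (1 - γ / 2 + γ / 2 * (u / (1 + r))) * v e =
      γ / (2 * (1 + r)) * ((2 * (q + r * p) - v e.symm - r * v e) - u * v e) := by
    field_simp
    ring
  rw [← sub_eq_zero, key, mul_eq_zero, or_iff_right (div_ne_zero h2 (mul_ne_zero two_ne_zero h1)),
    sub_eq_zero]

/-! ### From message eigenvectors to walk eigenvalues -/

section Eigenvectors

variable [Nontrivial V] {r : ℝ} {u : ℂ} {v : G.Dart → ℂ}

/-- Apply `B` to the eigenvalue equation: `B(2B - I) = B` because `B` is a projection. -/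
theorem dartAvg_symm_of_eigenvector (hG : G.Connected)
    (hv : IsMessageEigenvector r u v) (i : V) :
    dartAvg (fun e => v e.symm) i = (u - r) * dartAvg v i := by
  have h1 : dartAvg (fun e => (2 * (dartAvg (fun e => v e.symm) e.fst + r * dartAvg v e.fst) +
      (-1) * v e.symm) + (-r) * v e) i = dartAvg (fun e => u * v e) i := by
    congr 1
    ext e
    rw [← hv]; ring
  rw [dartAvg_add, dartAvg_add, dartAvg_mul, dartAvg_mul, dartAvg_mul, dartAvg_mul,
    dartAvg_fst hG fun i => dartAvg (fun e => v e.symm) i + r * dartAvg v i] at h1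
  linear_combination h1

/-- Once the averages of the reversed message are eliminated, averaging the equation taken at
reversed darts turns averages at the start node into averages at the neighbours. The result is `2u W
p = (1 + u² - r²) p` for the averages `p` of `v`. -/
theorem sum_dartAvg_of_eigenvector (hG : G.Connected)
    (hv : IsMessageEigenvector r u v) (i : V) :
    2 * u * ∑ j ∈ G.neighborFinset i, dartAvg v j =
      (1 + u ^ 2 - r ^ 2) * (deg G i * dartAvg v i) := by
  have hq := dartAvg_symm_of_eigenvector hG hv
  have h1 : dartAvg (fun e => ((2 * u) * dartAvg v e.snd + (-1) * v e) + (-r) * v e.symm) i =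
      dartAvg (fun e => u * v e.symm) i := by
    congr 1
    ext e
    have h2 := hv e.symm
    rw [hq, SimpleGraph.Dart.symm_symm] at h2
    rw [← h2]
    change 2 * u * dartAvg v e.snd + -1 * v e + -r * v e.symm =
      2 * ((u - r) * dartAvg v e.snd + r * dartAvg v e.snd) - v e - r * v e.symm
    ring
  rw [dartAvg_add, dartAvg_add, dartAvg_mul, dartAvg_mul, dartAvg_mul, dartAvg_mul, hq,
    dartAvg_snd fun j => dartAvg v j] at h1
  have h0 : (deg G i : ℂ) ≠ 0 := by exact_mod_cast (deg_pos hG i).ne'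
  have h2 : (deg G i : ℂ) * (deg G i : ℂ)⁻¹ = 1 := mul_inv_cancel₀ h0
  linear_combination deg G i * h1 - (2 * u * ∑ j ∈ G.neighborFinset i, dartAvg v j) * h2

/-- If all averages vanish, reversal acts on `v` as `-(u + r)`, and being an involution it forces `u
+ r = ±1`. Otherwise, for `u ≠ 0`, the averages form an eigenvector of the walk with eigenvalue `(1
+ u² - r²)/(2u)`, which is real by symmetry. -/
theorem eigenvector_classification (hG : G.Connected)
    (hv : IsMessageEigenvector r u v) (hv0 : v ≠ 0) :
    u = 1 - r ∨ u = -1 - r ∨ u = 0 ∨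
    ∃ (ω : ℝ) (x : V → ℝ), x ≠ 0 ∧ (G.adjMatrix ℝ).mulVec x = ω • (deg G * x) ∧
      u ^ 2 - 2 * ω * u + 1 - r ^ 2 = 0 := by
  have hq := dartAvg_symm_of_eigenvector hG hv
  by_cases hp : dartAvg v = 0
  · obtain ⟨e, he⟩ := Function.ne_iff.1 hv0
    have h1 := hv e
    have h2 := hv e.symm
    rw [hq, hp] at h1 h2
    rw [SimpleGraph.Dart.symm_symm] at h2
    simp only [Pi.zero_apply] at h1 h2
    have h3 : ((u + r) ^ 2 - 1) * v e = 0 := by linear_combination -(u + r) * h1 + h2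
    have h4 := (mul_eq_zero.1 h3).resolve_right he
    have h5 : (u - (1 - r)) * (u - (-1 - r)) = 0 := by linear_combination h4
    rcases mul_eq_zero.1 h5 with h | h
    · exact Or.inl (sub_eq_zero.1 h)
    · exact Or.inr (Or.inl (sub_eq_zero.1 h))
  by_cases hu : u = 0
  · exact Or.inr (Or.inr (Or.inl hu))
  refine Or.inr (Or.inr (Or.inr ?_))
  obtain ⟨ω, x, hω, hx0, hx, -⟩ := exists_real_eigenvector (G.isSymm_adjMatrix (α := ℝ)) (deg_pos hG)
    (l := (1 + u ^ 2 - r ^ 2) / (2 * u)) hp (fun i => by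
      have h1 := sum_dartAvg_of_eigenvector hG hv i
      have h2 : ∑ j, ((G.adjMatrix ℝ i j : ℝ) : ℂ) * dartAvg v j =
          ∑ j ∈ G.neighborFinset i, dartAvg v j := by
        rw [SimpleGraph.neighborFinset_eq_filter, Finset.sum_filter]
        refine Finset.sum_congr rfl fun j _ => ?_
        rw [SimpleGraph.adjMatrix_apply]
        split_ifs <;> simp
      rw [h2, div_mul_eq_mul_div, eq_div_iff (mul_ne_zero two_ne_zero hu), ← h1]
      ring)
  refine ⟨ω, x, hx0, hx, ?_⟩
  rw [div_eq_iff (mul_ne_zero two_ne_zero hu)] at hω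
  linear_combination hω

/-- The fixed points of the ADMM iteration are the constant messages. -/
theorem eigenvector_eq_const (hG : G.Connected)
    (hv : IsMessageEigenvector r u v) (hr : 0 < r) (hu : u = 1 + r) : ∃ c : ℂ, v = c • 1 := by
  have hq := dartAvg_symm_of_eigenvector hG hv
  have hr1 : (r : ℂ) ≠ 0 := by exact_mod_cast hr.ne'
  have hr2 : (1 + r : ℂ) ≠ 0 := by exact_mod_cast (by positivity : (1 + r : ℝ) ≠ 0)
  -- At `u = 1 + r` one has `1 + u² - r² = 2u`, so the averages are harmonic and hence constant.
  have hsum : ∀ i, ∑ j ∈ G.neighborFinset i, dartAvg v j = deg G i * dartAvg v i := by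
    intro i
    have h1 := sum_dartAvg_of_eigenvector hG hv i
    rw [hu] at h1
    have h2 : (2 * (1 + r) : ℂ) ≠ 0 := mul_ne_zero two_ne_zero hr2
    refine mul_left_cancel₀ h2 ?_
    rw [h1]; ring
  have hconst : ∀ i j, dartAvg v i = dartAvg v j := by
    intro i j
    refine Complex.ext ?_ ?_
    · refine eq_const_of_adjMatrix_mulVec hG (x := fun i => (dartAvg v i).re) ?_ i j
      ext i
      have := congrArg Complex.re (hsum i)
      rw [Complex.re_sum] at this
      rw [SimpleGraph.adjMatrix_mulVec_apply, this]
      simp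
    · refine eq_const_of_adjMatrix_mulVec hG (x := fun i => (dartAvg v i).im) ?_ i j
      ext i
      have := congrArg Complex.im (hsum i)
      rw [Complex.im_sum] at this
      rw [SimpleGraph.adjMatrix_mulVec_apply, this]
      simp
  obtain ⟨i⟩ := hG.nonempty
  refine ⟨dartAvg v i, ?_⟩
  ext e
  have h1 := hv e
  have h2 := hv e.symm
  rw [hq, hu, hconst _ i] at h1 h2
  rw [SimpleGraph.Dart.symm_symm] at h2
  -- The equations at a dart and at its reversal form a two-by-two system of determinant `(1 + 2r)²
  -- - 1 = 4r(1 + r)`.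
  have h3 : (4 * r * (1 + r) : ℂ) * v e = (4 * r * (1 + r)) * dartAvg v i := by
    linear_combination -(1 + 2 * r) * h1 + h2
  have h4 := mul_left_cancel₀ (mul_ne_zero (mul_ne_zero (by norm_num) hr1) hr2) h3
  simpa using h4

end Eigenvectors

/-! ### Message eigenvectors from walk eigenvectors and even cycles -/

theorem exists_eigenvector_of_walk_eigenvector [Nontrivial V] (hG : G.Connected) {r ω : ℝ} {u : ℂ}
    {x : V → ℝ} (hx0 : x ≠ 0) (hx : (G.adjMatrix ℝ).mulVec x = ω • (deg G * x)) (hω : ω ^ 2 ≠ 1)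
    (hu : u ^ 2 - 2 * ω * u + 1 - r ^ 2 = 0) : ∃ v : G.Dart → ℂ, v ≠ 0 ∧
      IsMessageEigenvector r u v := by
  have hsnd : ∀ i, dartAvg (fun e : G.Dart => (x e.snd : ℂ)) i = ω * x i := by
    intro i
    have h0 : (deg G i : ℂ) ≠ 0 := by exact_mod_cast (deg_pos hG i).ne'
    rw [dartAvg_snd fun j => (x j : ℂ)]
    have h1 := congrFun hx i
    rw [SimpleGraph.adjMatrix_mulVec_apply] at h1
    rw [← Complex.ofReal_sum, h1, inv_mul_eq_iff_eq_mul₀ h0]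
    simp
    ring
  have hfst : ∀ i, dartAvg (fun e : G.Dart => (x e.fst : ℂ)) i = x i :=
    dartAvg_fst hG fun i => (x i : ℂ)
  -- The eigenvalue equation requires `v e.symm + (u + r) v e` to depend on `e.fst` only; this
  -- combination of the two lifts of `x` cancels the `e.snd` terms.
  let v : G.Dart → ℂ := fun e => x e.snd + -(u + r) * x e.fst
  have hp : ∀ i, dartAvg v i = ω * x i + -(u + r) * x i := by
    intro i
    rw [dartAvg_add, dartAvg_mul, hsnd, hfst]
  have hq : ∀ i, dartAvg (fun e => v e.symm) i = x i + -(u + r) * (ω * x i) := by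
    intro i
    have h1 : (fun e => v e.symm) =
        fun e : G.Dart => (x e.fst : ℂ) + -(u + r) * (x e.snd : ℂ) := rfl
    rw [h1, dartAvg_add, dartAvg_mul, hsnd, hfst]
  refine ⟨v, fun hv0 => ?_, fun e => ?_⟩
  · obtain ⟨i, hi⟩ := Function.ne_iff.1 hx0
    have hi' : (x i : ℂ) ≠ 0 := by exact_mod_cast hi
    have h1 := hp i
    have h2 := hq i
    have h3 : (fun e => v e.symm) = (0 : G.Dart → ℂ) := by rw [hv0]; rfl
    have h4 : dartAvg (0 : G.Dart → ℂ) i = 0 := by simp [dartAvg]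
    rw [hv0, h4] at h1
    rw [h3, h4] at h2
    -- If `v = 0`, both its averages `(ω - (u + r)) x` and `(1 - (u + r) ω) x` vanish; eliminating
    -- `u + r` leaves `(1 - ω²) x = 0`.
    have h5 : (1 - (ω : ℂ) ^ 2) * x i = 0 := by linear_combination -h2 + ω * h1
    have h6 := (mul_eq_zero.1 h5).resolve_right hi'
    apply hω
    have h7 : ((ω ^ 2 : ℝ) : ℂ) = ((1 : ℝ) : ℂ) := by push_cast; linear_combination -h6
    exact_mod_cast h7
  · rw [hp, hq]
    change 2 * (x e.fst + -(u + r) * (ω * x e.fst) + r * (ω * x e.fst + -(u + r) * x e.fst)) -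
      (x e.fst + -(u + r) * x e.snd) - r * (x e.snd + -(u + r) * x e.fst) =
      u * (x e.snd + -(u + r) * x e.fst)
    linear_combination x e.fst * hu

/-- Consecutive edges carry opposite signs, so their contributions cancel at the node they share and
only the two ends of the walk remain. On a closed walk of even length these cancel as well. -/
theorem sum_alternatingFlow {u v : V} (p : G.Walk u v) (i : V) :
    (∑ e : G.Dart, if e.fst = i then alternatingFlow p e else 0) =
      (if u = i then 1 else 0) - (-1) ^ p.length * (if v = i then 1 else 0) := by
  induction p with
  | nil => simp [alternatingFlow]
  | @cons a b c h p ih =>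
    have h1 : ∀ e : G.Dart, (if e.fst = i then alternatingFlow (.cons h p) e else 0) =
        (if e = ⟨(a, b), h⟩ then (if e.fst = i then 1 else 0) else 0) +
        (if e = ⟨(b, a), h.symm⟩ then (if e.fst = i then 1 else 0) else 0) -
        (if e.fst = i then alternatingFlow p e else 0) := by
      intro e
      have h2 : e.symm = ⟨(a, b), h⟩ ↔ e = ⟨(b, a), h.symm⟩ := by
        constructor
        · intro h3; rw [← e.symm_symm, h3]; rfl
        · rintro rfl; rfl
      simp only [alternatingFlow, h2]
      split_ifs <;> ring
    simp_rw [h1]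
    rw [Finset.sum_sub_distrib, Finset.sum_add_distrib, ih, Finset.sum_ite_eq', Finset.sum_ite_eq']
    simp only [Finset.mem_univ, if_true, SimpleGraph.Walk.length_cons, pow_succ]
    ring

/-- An even cycle gives an eigenvector, with alternating signs along the cycle. -/
theorem exists_eigenvector_of_evenCycle (h : HasEvenCycle G) : ∃ v : G.Dart → ℂ, v ≠ 0 ∧
    ∀ r : ℝ, IsMessageEigenvector r (-1 - r) v := by
  obtain ⟨a, c, hc, heven⟩ := h
  have havg : ∀ i, dartAvg (alternatingFlow c) i = 0 := by
    intro i
    rw [dartAvg, sum_alternatingFlow, heven.neg_one_pow, one_mul, sub_self, mul_zero]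
  refine ⟨alternatingFlow c, ?_, fun r e => ?_⟩
  · cases c with
    | nil => exact absurd rfl hc.ne_nil
    | @cons _ b _ h p =>
      intro h0
      have h1 := congrFun h0 ⟨(a, b), h⟩
      -- A cycle does not repeat its first edge, so the flow there is `1` and is not cancelled
      -- later.
      have h2 : s(a, b) ∉ p.edges := ((SimpleGraph.Walk.isTrail_cons _ _).1 hc.isTrail).2
      simp [alternatingFlow, h.ne, alternatingFlow_eq_zero p ⟨(a, b), h⟩ h2] at h1
  · simp_rw [alternatingFlow_symm]
    rw [show (fun e => alternatingFlow c e) = alternatingFlow c from rfl, havg]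
    ring

/-! Row and column sums. -/

theorem matB_mulVec_one [Nontrivial V] (hG : G.Connected) : (matB G).mulVec 1 = 1 := by
  ext e
  have h := matB_mulVec_complex hG 1 e
  have h2 : dartAvg (1 : G.Dart → ℂ) e.fst = 1 := dartAvg_fst hG (fun _ => 1) e.fst
  rw [h2] at h
  simp only [Matrix.mulVec, dotProduct, Matrix.map_apply, Pi.one_apply, mul_one] at h ⊢
  rw [← map_sum] at h
  exact (algebraMap ℝ ℂ).injective (by rw [h, map_one])

theorem matB_transpose [Nontrivial V] (hG : G.Connected) : (matB G).transpose = matB G := by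
  ext e e'
  rw [Matrix.transpose_apply, matB_apply hG, matB_apply hG]
  by_cases h : e.fst = e'.fst
  · simp [h]
  · simp [h, Ne.symm h]

theorem matA_mulVec_one {ρ : ℝ} (hρ : 0 < ρ) : (matA G ρ).mulVec 1 = 1 := by
  have h1 : (flipMatrix G).mulVec 1 = 1 := by
    ext e; simp [flipMatrix, Matrix.mulVec, dotProduct]
  rw [matA_eq hρ, Matrix.add_mulVec, Matrix.smul_mulVec, Matrix.smul_mulVec, Matrix.one_mulVec, h1,
    ← add_smul]
  have h2 : (ρ + 1) / (ρ + 2) + 1 / (ρ + 2) = 1 := by field_simp; ring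
  rw [h2, one_smul]

theorem admmMatrix_mulVec_one [Nontrivial V] (hG : G.Connected) {γ ρ : ℝ} (hρ : 0 < ρ) :
    (admmMatrix G γ ρ).mulVec 1 = 1 := by
  rw [admmMatrix, Matrix.sub_mulVec, Matrix.one_mulVec, Matrix.smul_mulVec, Matrix.sub_mulVec,
    Matrix.add_mulVec, Matrix.smul_mulVec, ← Matrix.mulVec_mulVec, matA_mulVec_one hρ,
    matB_mulVec_one hG, two_smul, sub_self, smul_zero, sub_zero]

theorem one_vecMul_admmMatrix [Nontrivial V] (hG : G.Connected) {γ ρ : ℝ} (hρ : 0 < ρ) :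
    Matrix.vecMul 1 (admmMatrix G γ ρ) = 1 := by
  have hA : (matA G ρ).transpose = matA G ρ := by
    rw [matA_eq hρ, Matrix.transpose_add, Matrix.transpose_smul, Matrix.transpose_smul,
      Matrix.transpose_one, flipMatrix_transpose]
  have hA1 : Matrix.vecMul 1 (matA G ρ) = 1 := by
    rw [← Matrix.mulVec_transpose, hA, matA_mulVec_one hρ]
  have hB1 : Matrix.vecMul 1 (matB G) = 1 := by
    rw [← Matrix.mulVec_transpose, matB_transpose hG, matB_mulVec_one hG]
  rw [admmMatrix, Matrix.vecMul_sub, Matrix.vecMul_one, Matrix.vecMul_smul, Matrix.vecMul_sub,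
    Matrix.vecMul_add, Matrix.vecMul_smul, ← Matrix.vecMul_vecMul, hA1, hB1, hA1, two_smul,
    sub_self, smul_zero, sub_zero]

end Graph

/-! ### The optimal rate of ADMM -/

/-- The parameter `s = √((2 - ρ) / (2 + ρ))` of the optimal penalty `ρ = 2 √(1 - ω ^ 2)`. -/
def optParam (ω : ℝ) : ℝ := ω / (1 + √(1 - ω ^ 2))

theorem optParam_nonneg {ω : ℝ} (h : 0 ≤ ω) : 0 ≤ optParam ω := by
  rw [optParam]; positivity

theorem optParam_lt_one {ω : ℝ} (h : ω < 1) : optParam ω < 1 := by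
  have := Real.sqrt_nonneg (1 - ω ^ 2)
  rw [optParam, div_lt_one (by positivity)]
  linarith

/-- Half-angle substitution: with `ω = sin θ`, `optParam ω` is `tan (θ/2)`. It makes `ω` and `√(1 -
ω²)` rational functions of `s`. -/
theorem mul_one_add_optParam_sq {ω : ℝ} (h0 : 0 ≤ ω) (h1 : ω < 1) :
    ω * (1 + optParam ω ^ 2) = 2 * optParam ω := by
  have h2 : 0 ≤ 1 - ω ^ 2 := by nlinarith
  have h3 := Real.sq_sqrt h2
  have h4 := Real.sqrt_nonneg (1 - ω ^ 2)
  rw [optParam]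
  set q := √(1 - ω ^ 2)
  have h5 : 1 + q ≠ 0 := by positivity
  field_simp
  linear_combination ω * h3

/-- The eigenvalues at the optimal parameters that come from the eigenvalues of the walk. -/
theorem norm_le_of_quadratic {s η : ℝ} (hs0 : 0 ≤ s) (hs1 : s < 1) (hη : η ≤ s)
    (hη' : -(1 + s ^ 2) ≤ 2 * η) {z : ℂ} (hz : z ^ 2 - 2 * η * z + s ^ 2 = 0) :
    ‖1 - s + 2 * z‖ ≤ 1 + s := by
  have hre := congrArg Complex.re hz
  have him := congrArg Complex.im hz
  simp [pow_two] at hre him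
  rw [← sq_le_sq₀ (norm_nonneg _) (by linarith), Complex.sq_norm, Complex.normSq_apply]
  simp
  set a := z.re
  set b := z.im
  have h1 : b * (a - η) = 0 := by linear_combination him / 2
  rcases mul_eq_zero.1 h1 with hb | ha
  -- Real root: the required range is `-1 ≤ z ≤ s`. The lower end uses that the quadratic takes the
  -- nonnegative value `1 + 2η + s²` at `-1` and that the product of the roots is `s² < 1`.
  · rw [hb] at hre ⊢
    have h2 : (a - η) ^ 2 = η ^ 2 - s ^ 2 := by linear_combination hre
    have h3 : a ≤ s := by
      by_contra hlt
      push Not at hlt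
      nlinarith
    have h4 : -1 ≤ a := by
      by_contra hlt
      push Not at hlt
      have h5 : s ^ 2 < 1 := by nlinarith
      nlinarith [mul_nonneg (show 0 ≤ 2 * η + (1 + s ^ 2) by linarith) (show 0 ≤ -a by linarith),
        mul_pos (show 0 < -1 - a by linarith) (show 0 < -s ^ 2 - a by linarith)]
    nlinarith
  -- Here `|z| = s` and the real part of `z` is `η ≤ s`, so the squared modulus is at most `(1 - s)²
  -- + 4s(1 - s) + 4s² = (1 + s)²`.
  · have h2 : a = η := by linarith
    rw [h2] at hre ⊢
    have h3 : b * b = s * s - η * η := by linear_combination -hre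
    nlinarith

/-- Let `q = √(1 - ω²)` and `w = u/(1 + r)`. For `r ≤ q` the roots are conjugate with `|w|² = (1 -
r)/(1 + r) ≥ (1 - q)/(1 + q) = s²` and `Re w = ω/(1 + r) ≥ s`. For `r ≥ q` the larger real root
satisfies `w ≥ s`. As `1 - γ/2 > 0`, either case bounds the modulus below by its value at `w = s`.
-/
theorem exists_root_with_large_norm {ω r γ : ℝ} (h0 : 0 ≤ ω) (h1 : ω < 1) (hr : 0 < r)
    (hγ0 : 0 < γ) (hγ2 : γ < 2) : ∃ u : ℂ, u ^ 2 - 2 * ω * u + 1 - r ^ 2 = 0 ∧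
      1 - γ / 2 * (1 - optParam ω) ≤ ‖(1 - γ / 2 + γ / 2 * (u / (1 + r)) : ℂ)‖ := by
  have hpos : 0 ≤ 1 - ω ^ 2 := by nlinarith
  have hs : optParam ω = ω / (1 + √(1 - ω ^ 2)) := rfl
  have hq2 := Real.sq_sqrt hpos
  have hq0 := Real.sqrt_nonneg (1 - ω ^ 2)
  have hs0 := optParam_nonneg h0
  set q := √(1 - ω ^ 2) with hq
  set s := optParam ω
  have hsq : s * (1 + q) = ω := by rw [hs]; field_simp
  have hr1 : 0 < 1 + r := by positivity
  have hq1 : q ≤ 1 := by nlinarith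
  have hk : 0 < 1 - γ / 2 := by linarith
  rcases le_total r q with hrq | hrq
  · have hd : 0 ≤ q ^ 2 - r ^ 2 := by nlinarith
    set d := √(q ^ 2 - r ^ 2)
    have hd2 : d ^ 2 = q ^ 2 - r ^ 2 := Real.sq_sqrt hd
    refine ⟨ω + d * Complex.I, ?_, ?_⟩
    · have h2 : (d : ℂ) ^ 2 = 1 - ω ^ 2 - r ^ 2 := by
        rw [← hq2.symm] at hd2; exact_mod_cast hd2
      linear_combination (d : ℂ) ^ 2 * Complex.I_sq - h2
    · refine le_of_sq_le_sq ?_ (norm_nonneg _)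
      have h2 : (1 - γ / 2 + γ / 2 * ((ω + d * Complex.I) / (1 + r)) : ℂ) =
          ((1 - γ / 2 + γ / 2 * (ω / (1 + r)) : ℝ) : ℂ) +
            ((γ / 2 * (d / (1 + r)) : ℝ) : ℂ) * Complex.I := by
        push_cast; ring
      rw [h2, Complex.sq_norm, Complex.normSq_add_mul_I]
      have h3 : s ≤ ω / (1 + r) := by
        rw [le_div_iff₀ hr1]; nlinarith
      have h4 : s ^ 2 * (1 + q) = 1 - q := by
        have h5 : (1 + q) * (s ^ 2 * (1 + q)) = (1 + q) * (1 - q) := by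
          linear_combination (s * (1 + q) + ω) * hsq + hq2
        exact mul_left_cancel₀ (by positivity) h5
      have h5 : s ^ 2 ≤ (ω / (1 + r)) ^ 2 + (d / (1 + r)) ^ 2 := by
        rw [div_pow, div_pow, ← add_div, le_div_iff₀ (by positivity), hd2, hq2]
        have h6 : s ^ 2 * (1 + r) ≤ 1 - r := by nlinarith [sq_nonneg s]
        nlinarith
      nlinarith [mul_nonneg (mul_nonneg hk.le hγ0.le) (sub_nonneg.2 h3),
        mul_nonneg (mul_nonneg hγ0.le hγ0.le) (sub_nonneg.2 h5)]
  · have hd : 0 ≤ r ^ 2 - q ^ 2 := by nlinarith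
    have hd0 := Real.sqrt_nonneg (r ^ 2 - q ^ 2)
    have hd2 : √(r ^ 2 - q ^ 2) ^ 2 = r ^ 2 - q ^ 2 := Real.sq_sqrt hd
    set d := √(r ^ 2 - q ^ 2)
    refine ⟨((ω + d : ℝ) : ℂ), ?_, ?_⟩
    · have h2 : (ω + d) ^ 2 - 2 * ω * (ω + d) + 1 - r ^ 2 = 0 := by
        linear_combination hd2 - hq2
      exact_mod_cast h2
    · have h2 : (1 - γ / 2 + γ / 2 * (((ω + d : ℝ) : ℂ) / (1 + r)) : ℂ) =
          ((1 - γ / 2 + γ / 2 * ((ω + d) / (1 + r)) : ℝ) : ℂ) := by push_cast; ring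
      rw [h2, Complex.norm_real, Real.norm_eq_abs]
      refine le_trans ?_ (le_abs_self _)
      have hdr : d ≤ r := by nlinarith
      have h4 : s ≤ 1 := (optParam_lt_one h1).le
      have h5 : s * (r - q) ≤ d := by
        rcases eq_or_lt_of_le hrq with h | h
        · rw [← h, sub_self, mul_zero]; exact hd0
        · have h6 : r - q ≤ d := by nlinarith
          nlinarith
      have h3 : s ≤ (ω + d) / (1 + r) := by
        rw [le_div_iff₀ hr1]
        nlinarith
      nlinarith

section Graph

theorem nonempty_dart {V : Type*} [Fintype V] {G : SimpleGraph V} [DecidableRel G.Adj]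
    [Nontrivial V] (hG : G.Connected) : Nonempty G.Dart := by
  obtain ⟨i⟩ := hG.nonempty
  obtain ⟨j, hj⟩ := (G.degree_pos_iff_exists_adj i).1 (hG.preconnected.degree_pos_of_nontrivial i)
  exact ⟨⟨(i, j), hj⟩⟩

variable {V : Type*} [Fintype V] [DecidableEq V] {G : SimpleGraph V} [DecidableRel G.Adj]
  [Nontrivial V]

theorem admmMatrix_map_mulVec_one (hG : G.Connected) {γ ρ : ℝ} (hρ : 0 < ρ) :
    ((admmMatrix G γ ρ).map (algebraMap ℝ ℂ)).mulVec 1 = 1 := by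
  have h := admmMatrix_mulVec_one hG (γ := γ) hρ
  ext e
  have h1 := congrFun h e
  simp only [Matrix.mulVec, dotProduct, Matrix.map_apply, Pi.one_apply, mul_one] at h1 ⊢
  rw [← map_sum, h1, map_one]

theorem one_vecMul_admmMatrix_map (hG : G.Connected) {γ ρ : ℝ} (hρ : 0 < ρ) :
    Matrix.vecMul 1 ((admmMatrix G γ ρ).map (algebraMap ℝ ℂ)) = 1 := by
  have h := one_vecMul_admmMatrix hG (γ := γ) hρ
  ext e
  have h1 := congrFun h e
  simp only [Matrix.vecMul, dotProduct, Matrix.map_apply, Pi.one_apply, one_mul] at h1 ⊢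
  rw [← map_sum, h1, map_one]

/-- The eigenvalue equation for `T_A` at an arbitrary eigenvalue. -/
theorem isMessageEigenvector_of_mulVec (hG : G.Connected) {γ r : ℝ} (hγ : 0 < γ) (hr : 0 < r)
    {l : ℂ} {v : G.Dart → ℂ}
    (hv : ((admmMatrix G γ (2 * r)).map (algebraMap ℝ ℂ)).mulVec v = l • v) :
    ∃ u : ℂ, l = 1 - γ / 2 + γ / 2 * (u / (1 + r)) ∧ IsMessageEigenvector r u v := by
  have h1 : (1 + r : ℂ) ≠ 0 := by exact_mod_cast (by positivity : (1 + r : ℝ) ≠ 0)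
  have h2 : (γ : ℂ) ≠ 0 := by exact_mod_cast hγ.ne'
  have hl : l = 1 - γ / 2 + γ / 2 * (((l - 1 + γ / 2) * (2 / γ) * (1 + r)) / (1 + r)) := by
    field_simp
    ring
  refine ⟨_, hl, (admmMatrix_mulVec_eq_smul_iff hG hγ hr).1 ?_⟩
  rw [← hl, hv]

theorem admmMatrix_fixed_eq_const (hG : G.Connected) {γ r : ℝ} (hγ : 0 < γ) (hr : 0 < r)
    {v : G.Dart → ℂ} (hv : ((admmMatrix G γ (2 * r)).map (algebraMap ℝ ℂ)).mulVec v = v) :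
    ∃ c : ℂ, v = c • 1 := by
  have h1 : (1 + r : ℂ) ≠ 0 := by exact_mod_cast (by positivity : (1 + r : ℝ) ≠ 0)
  refine eigenvector_eq_const hG (r := r) (u := 1 + r) ?_ hr rfl
  refine (admmMatrix_mulVec_eq_smul_iff hG hγ hr).1 ?_
  rw [hv, div_self h1, mul_one, sub_add_cancel, one_smul]

/-- The bound `1 - (γ/2)(1 - s)` decreases in `γ` and `γ - 1` increases; they agree at `γ = 4/(3 -
s)`, with value `(1 + s)/(3 - s)`. Above that `γ` the even cycle supplies the eigenvalue, below it
`ω⋆` does. -/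
theorem exists_large_eigenvalue (hG : G.Connected) (hc : HasEvenCycle G) (h0 : 0 ≤ omegaStar G)
    {γ r : ℝ} (hγ0 : 0 < γ) (hγ2 : γ < 2) (hr : 0 < r) :
    ∃ (l : ℂ) (v : G.Dart → ℂ), l ≠ 1 ∧ v ≠ 0 ∧
      (1 + optParam (omegaStar G)) / (3 - optParam (omegaStar G)) ≤ ‖l‖ ∧
      ((admmMatrix G γ (2 * r)).map (algebraMap ℝ ℂ)).mulVec v = l • v := by
  obtain ⟨h1, ⟨x, hx0, -, hx⟩, -⟩ := omegaStar_spec hG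
  have hs1 := optParam_lt_one h1
  have hs0 := optParam_nonneg h0
  set ω := omegaStar G
  set s := optParam ω
  have hr1 : (1 + r : ℂ) ≠ 0 := by exact_mod_cast (by positivity : (1 + r : ℝ) ≠ 0)
  have hγ : (γ : ℂ) ≠ 0 := by exact_mod_cast hγ0.ne'
  have hne : ∀ u : ℂ, u ≠ 1 + r → (1 - γ / 2 + γ / 2 * (u / (1 + r)) : ℂ) ≠ 1 := by
    intro u hu h
    apply hu
    have h2 : (γ / 2 : ℂ) * (u / (1 + r)) = γ / 2 * 1 := by linear_combination h
    have h3 := mul_left_cancel₀ (div_ne_zero hγ two_ne_zero) h2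
    rwa [div_eq_one_iff_eq hr1] at h3
  by_cases hcase : (1 + s) / (3 - s) ≤ γ - 1
  · obtain ⟨v, hv0, hv⟩ := exists_eigenvector_of_evenCycle hc
    refine ⟨_, v, hne (-1 - r) ?_, hv0, ?_, (admmMatrix_mulVec_eq_smul_iff hG hγ0 hr).2 (hv r)⟩
    · intro h
      have h2 : (2 * (1 + r) : ℂ) = 0 := by linear_combination -h
      exact (mul_ne_zero two_ne_zero hr1) h2
    · have h2 : (1 - γ / 2 + γ / 2 * ((-1 - r) / (1 + r)) : ℂ) = ((1 - γ : ℝ) : ℂ) := by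
        push_cast; field_simp; ring
      rw [h2, Complex.norm_real, Real.norm_eq_abs]
      refine hcase.trans ?_
      have := neg_abs_le (1 - γ)
      linarith
  · push Not at hcase
    obtain ⟨u, hu, hnorm⟩ := exists_root_with_large_norm h0 h1 hr hγ0 hγ2
    obtain ⟨v, hv0, hv⟩ := exists_eigenvector_of_walk_eigenvector hG hx0 hx (by nlinarith) hu
    refine ⟨_, v, hne u ?_, hv0, ?_, (admmMatrix_mulVec_eq_smul_iff hG hγ0 hr).2 hv⟩
    · rintro rfl
      have h2 : (2 * (1 + r) : ℂ) * (1 - ω) = 0 := by linear_combination hu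
      have h3 := (mul_eq_zero.1 h2).resolve_left (mul_ne_zero two_ne_zero hr1)
      have h4 : (1 - ω : ℝ) = 0 := by exact_mod_cast h3
      linarith
    · refine le_trans ?_ hnorm
      rw [lt_div_iff₀ (by linarith)] at hcase
      rw [div_le_iff₀ (by linarith)]
      nlinarith

/-- At the optimal parameters all eigenvalues but the simple eigenvalue `1` are small. -/
theorem norm_eigenvalue_le_opt (hG : G.Connected) (h0 : 0 ≤ omegaStar G) {s : ℝ}
    (hs : s = optParam (omegaStar G)) {l : ℂ} {v : G.Dart → ℂ} (hl : l ≠ 1) (hv0 : v ≠ 0)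
    (hv : ((admmMatrix G (4 / (3 - s)) (2 * ((1 - s ^ 2) / (1 + s ^ 2)))).map
      (algebraMap ℝ ℂ)).mulVec v = l • v) : ‖l‖ ≤ (1 + s) / (3 - s) := by
  have h1 := (omegaStar_spec hG).1
  have hs1 : s < 1 := hs ▸ optParam_lt_one h1
  have hs0 : 0 ≤ s := hs ▸ optParam_nonneg h0
  have hωs : omegaStar G * (1 + s ^ 2) = 2 * s := hs ▸ mul_one_add_optParam_sq h0 h1
  have h3s : 0 < 3 - s := by linarith
  have hss : 0 < 1 + s ^ 2 := by positivity
  have hr : 0 < (1 - s ^ 2) / (1 + s ^ 2) := div_pos (by nlinarith) hss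
  obtain ⟨u, hlu, hu⟩ := isMessageEigenvector_of_mulVec hG (div_pos four_pos h3s) hr hv
  have h3s' : (3 - s : ℂ) ≠ 0 := by exact_mod_cast h3s.ne'
  have hss' : (1 + s ^ 2 : ℂ) ≠ 0 := by exact_mod_cast hss.ne'
  -- Since `1 + r = 2/(1 + s²)`, it suffices to bound `|1 - s + w|` by `1 + s` for `w = (1 + s²) u`.
  have hl2 : l = (1 - s + (1 + s ^ 2) * u) / ((3 - s : ℝ) : ℂ) := by
    rw [hlu]
    push_cast
    have h2 : (1 + (1 - s ^ 2) / (1 + s ^ 2) : ℂ) = 2 / (1 + s ^ 2) := by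
      field_simp; ring
    rw [h2]
    field_simp
    ring
  have hw : ∀ w : ℂ, (1 + s ^ 2) * u = w → ‖1 - s + w‖ ≤ 1 + s → ‖l‖ ≤ (1 + s) / (3 - s) := by
    rintro w rfl hw
    rw [hl2, norm_div, Complex.norm_real, Real.norm_of_nonneg h3s.le]
    exact div_le_div_of_nonneg_right hw h3s.le
  have hr' : ((1 + s ^ 2) * (((1 - s ^ 2) / (1 + s ^ 2) : ℝ) : ℂ) : ℂ) = 1 - s ^ 2 := by
    push_cast; field_simp
  have hreal : ∀ w : ℝ, |1 - s + w| ≤ 1 + s → ‖(1 - s + w : ℂ)‖ ≤ 1 + s := by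
    intro w hw
    rw [← Real.norm_eq_abs, ← Complex.norm_real] at hw
    exact_mod_cast hw
  have hcase1 : u = 1 - (((1 - s ^ 2) / (1 + s ^ 2) : ℝ) : ℂ) → ‖l‖ ≤ (1 + s) / (3 - s) := by
    intro h
    refine hw ((2 * s ^ 2 : ℝ) : ℂ) ?_ (hreal _ ?_)
    · rw [h, mul_sub, hr']; push_cast; ring
    · rw [abs_le]; constructor <;> nlinarith
  rcases eigenvector_classification hG hu hv0 with h | h | h | ⟨ω, x, hx0, hx, h⟩
  · exact hcase1 h
  · refine hw ((-2 : ℝ) : ℂ) ?_ (hreal _ ?_)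
    · rw [h, mul_sub, hr']; push_cast; ring
    · rw [abs_le]; constructor <;> linarith
  · refine hw ((0 : ℝ) : ℂ) ?_ (hreal _ ?_)
    · rw [h]; simp
    · rw [abs_le]; constructor <;> linarith
  · set r : ℝ := (1 - s ^ 2) / (1 + s ^ 2)
    -- The walk eigenvalue `1` yields `u = 1 ± r`, and `u = 1 + r` is the excluded eigenvalue `l =
    -- 1`. All other `ω` lie in `[-1, ω⋆]`.
    by_cases hω1 : ω = 1
    · rw [hω1] at h
      have h2 : (u - (1 - r)) * (u - (1 + r)) = 0 := by
        push_cast at h; linear_combination h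
      rcases mul_eq_zero.1 h2 with h2 | h2
      · exact hcase1 (sub_eq_zero.1 h2)
      · have hr1 : (1 + r : ℂ) ≠ 0 := by exact_mod_cast (by positivity : (1 + r : ℝ) ≠ 0)
        refine absurd ?_ hl
        rw [hlu, sub_eq_zero.1 h2, div_self hr1, mul_one, sub_add_cancel]
    · have hω2 := eigenvalue_le_omegaStar hG hx0 hx hω1
      have hω3 := (abs_le.1 (abs_eigenvalue_le_one hG hx0 hx)).1
      refine hw (2 * ((1 + s ^ 2) * u / 2)) (by ring) ?_
      refine norm_le_of_quadratic (η := ω * (1 + s ^ 2) / 2) hs0 hs1 (by nlinarith) (by nlinarith) ?_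
      push_cast
      linear_combination (1 + s ^ 2) ^ 2 / 4 * h +
        ((1 + s ^ 2) * (r : ℂ) + (1 - s ^ 2)) / 4 * hr'

theorem admm_isLeast (hG : G.Connected) (hc : HasEvenCycle G) (h0 : 0 ≤ omegaStar G) :
    IsLeast (admmRates G) ((1 + optParam (omegaStar G)) / (3 - optParam (omegaStar G))) ∧
    IsLeast (admmSecondModuli G)
      ((1 + optParam (omegaStar G)) / (3 - optParam (omegaStar G))) := by
  have h1 := (omegaStar_spec hG).1
  have hs1 := optParam_lt_one h1
  have hs0 := optParam_nonneg h0
  set s := optParam (omegaStar G) with hs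
  have h3s : 0 < 3 - s := by linarith
  have hτ : (1 + s) / (3 - s) < 1 := by rw [div_lt_one h3s]; linarith
  have hγ0 : 0 < 4 / (3 - s) := by positivity
  have hγ2 : 4 / (3 - s) < 2 := by rw [div_lt_iff₀ h3s]; linarith
  have hr : 0 < (1 - s ^ 2) / (1 + s ^ 2) := div_pos (by nlinarith) (by positivity)
  have hne := nonempty_dart hG
  have hone : (1 : G.Dart → ℂ) ≠ 0 := one_ne_zero
  obtain ⟨l, v, hl, hv0, hnorm, hv⟩ := exists_large_eigenvalue hG hc h0 hγ0 hγ2 hr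
  have hnorm' := le_antisymm (norm_eigenvalue_le_opt hG h0 hs hl hv0 hv) hnorm
  refine ⟨⟨⟨_, _, hγ0, hγ2, mul_pos two_pos hr, ?_⟩, ?_⟩,
    ⟨⟨_, _, hγ0, hγ2, mul_pos two_pos hr, ?_⟩, ?_⟩⟩
  · refine hasRate_of_stochastic hτ (fun e => ?_) (fun e => ?_) ⟨l, v, hl, hnorm', hv0, hv⟩ ?_
    · have := congrFun (admmMatrix_mulVec_one hG (γ := 4 / (3 - s)) (mul_pos two_pos hr)) e
      simpa [Matrix.mulVec, dotProduct] using this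
    · have := congrFun (one_vecMul_admmMatrix hG (γ := 4 / (3 - s)) (mul_pos two_pos hr)) e
      simpa [Matrix.vecMul, dotProduct] using this
    · intro l' v' hv0' hsum hv'
      refine norm_eigenvalue_le_opt hG h0 hs ?_ hv0' hv'
      rintro rfl
      rw [one_smul] at hv'
      obtain ⟨c, rfl⟩ := admmMatrix_fixed_eq_const hG hγ0 hr hv'
      simp at hsum
      exact hv0' (by simp [hsum])
  · rintro τ ⟨γ, ρ, hγ, hγ', hρ, hrate⟩
    obtain ⟨r, rfl⟩ : ∃ r, ρ = 2 * r := ⟨ρ / 2, by ring⟩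
    obtain ⟨l, v, hl, hv0, hnorm, hv⟩ := exists_large_eigenvalue hG hc h0 hγ hγ' (r := r)
      (by linarith)
    exact hnorm.trans (hrate.norm_eigenvalue_le hl hv0 hv)
  · refine (secondModulus_eq ?_ hτ.le ⟨l, v, hl, hnorm', hv0, hv⟩
      fun l' v' hl' hv0' hv' => norm_eigenvalue_le_opt hG h0 hs hl' hv0' hv').symm
    refine count_roots_charpoly_eq_one (u := 1) (w := 1) ?_ ?_ ?_ ?_
    · rw [admmMatrix_map_mulVec_one hG (mul_pos two_pos hr), one_smul]
    · rw [one_vecMul_admmMatrix_map hG (mul_pos two_pos hr), one_smul]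
    · simp
    · intro w hw
      rw [one_smul] at hw
      exact admmMatrix_fixed_eq_const hG hγ0 hr hw
  · rintro τ ⟨γ, ρ, hγ, hγ', hρ, rfl⟩
    obtain ⟨r, rfl⟩ : ∃ r, ρ = 2 * r := ⟨ρ / 2, by ring⟩
    obtain ⟨l, v, hl, hv0, hnorm, hv⟩ := exists_large_eigenvalue hG hc h0 hγ hγ' (r := r)
      (by linarith)
    exact le_secondModulus hτ.le hone (admmMatrix_map_mulVec_one hG hρ) hl hnorm hv0 hv

end Graph

/-! ### The optimal rate of gradient descent -/

theorem dotProduct_sub_const {ι : Type*} [Fintype ι] (d x : ι → ℝ) (c : ℝ) :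
    (fun i => x i - c) ⬝ᵥ (d * fun i => x i - c) =
      x ⬝ᵥ (d * x) - 2 * c * (d ⬝ᵥ x) + c ^ 2 * ∑ i, d i := by
  simp only [dotProduct, Pi.mul_apply, Finset.mul_sum]
  rw [← Finset.sum_sub_distrib, ← Finset.sum_add_distrib]
  exact Finset.sum_congr rfl fun i _ => by ring

section Graph

variable {V : Type*} [Fintype V] {G : SimpleGraph V} [DecidableRel G.Adj]

theorem deg_le_maxDegree (i : V) : deg G i ≤ G.maxDegree := Nat.cast_le.2 (G.degree_le_maxDegree i)

theorem minDegree_le_deg (i : V) : (G.minDegree : ℝ) ≤ deg G i :=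
  Nat.cast_le.2 (G.minDegree_le_degree i)

variable [DecidableEq V]

theorem dotProduct_lapMatrix_sub_const (x : V → ℝ) (c : ℝ) :
    (fun i => x i - c) ⬝ᵥ (G.lapMatrix ℝ).mulVec (fun i => x i - c) =
      x ⬝ᵥ (G.lapMatrix ℝ).mulVec x := by
  rw [dotProduct_lapMatrix_mulVec, dotProduct_lapMatrix_mulVec]
  simp only [sub_sub_sub_cancel_right]

theorem dotProduct_lapMatrix_le (x : V → ℝ) :
    x ⬝ᵥ (G.lapMatrix ℝ).mulVec x ≤ 2 * (x ⬝ᵥ (deg G * x)) := by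
  have h1 : ∀ f : V → ℝ, ∑ i : V, ∑ j : V, (if G.Adj i j then f i else 0) = ∑ i, deg G i * f i := by
    intro f
    refine Finset.sum_congr rfl fun i _ => ?_
    rw [← Finset.sum_filter, Finset.sum_const, ← SimpleGraph.neighborFinset_eq_filter,
      SimpleGraph.card_neighborFinset_eq_degree, nsmul_eq_mul]
    rfl
  have h2 : ∑ i : V, ∑ j : V, (if G.Adj i j then x j ^ 2 else 0) = ∑ i, deg G i * x i ^ 2 := by
    rw [Finset.sum_comm]
    simp_rw [G.adj_comm]
    exact h1 fun i => x i ^ 2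
  have h3 : (∑ i : V, ∑ j : V, if G.Adj i j then (x i - x j) ^ 2 else 0) ≤
      2 * (∑ i : V, ∑ j : V, (if G.Adj i j then x i ^ 2 else 0)) +
        2 * (∑ i : V, ∑ j : V, (if G.Adj i j then x j ^ 2 else 0)) := by
    simp_rw [Finset.mul_sum, ← Finset.sum_add_distrib]
    refine Finset.sum_le_sum fun i _ => Finset.sum_le_sum fun j _ => ?_
    split_ifs
    · nlinarith [sq_nonneg (x i + x j)]
    · simp
  rw [h1 fun i => x i ^ 2, h2] at h3
  have h4 : x ⬝ᵥ (deg G * x) = ∑ i, deg G i * x i ^ 2 :=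
    Finset.sum_congr rfl fun i _ => by simp only [Pi.mul_apply]; ring
  rw [dotProduct_lapMatrix_mulVec, h4]
  linarith

/-- The extremal eigenvalues of the Laplacian on the vectors of sum zero. -/
theorem exists_extremal_lapMatrix_eigenvalues [Nontrivial V] (hG : G.Connected) :
    ∃ m M : ℝ, 0 < m ∧ m ≤ M ∧
      (∃ x : V → ℝ, x ≠ 0 ∧ 1 ⬝ᵥ x = 0 ∧ (G.lapMatrix ℝ).mulVec x = m • x) ∧
      (∃ x : V → ℝ, x ≠ 0 ∧ 1 ⬝ᵥ x = 0 ∧ (G.lapMatrix ℝ).mulVec x = M • x) ∧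
      ∀ y : V → ℝ, 1 ⬝ᵥ y = 0 → m * (y ⬝ᵥ y) ≤ y ⬝ᵥ (G.lapMatrix ℝ).mulVec y ∧
        y ⬝ᵥ (G.lapMatrix ℝ).mulVec y ≤ M * (y ⬝ᵥ y) := by
  have hL1 : (G.lapMatrix ℝ).mulVec 1 = 0 := SimpleGraph.lapMatrix_mulVec_const_eq_zero G
  obtain ⟨M, z, hz0, hzu, hz, hmax⟩ := exists_max_eigenvalue_orthogonal
    (G.isSymm_lapMatrix (R := ℝ)) (u := 1) (θ := 0) (by rw [hL1, zero_smul])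
  obtain ⟨m, x, hx0, hxu, hx, hmin⟩ := exists_max_eigenvalue_orthogonal (M := -G.lapMatrix ℝ)
    (G.isSymm_lapMatrix (R := ℝ)).neg (u := 1) (θ := 0)
    (by rw [Matrix.neg_mulVec, hL1, zero_smul, neg_zero])
  have hx' : (G.lapMatrix ℝ).mulVec x = (-m) • x := by
    rw [neg_smul, ← hx, Matrix.neg_mulVec, neg_neg]
  have hxx : 0 < x ⬝ᵥ x := by
    have := dotProduct_self_pos_of_pos (d := 1) (fun _ => one_pos) hx0
    rwa [one_mul] at this
  have hmin' : ∀ y : V → ℝ, 1 ⬝ᵥ y = 0 → -m * (y ⬝ᵥ y) ≤ y ⬝ᵥ (G.lapMatrix ℝ).mulVec y := by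
    intro y hy
    have := hmin y hy
    rw [Matrix.neg_mulVec, dotProduct_neg] at this
    linarith
  refine ⟨-m, M, ?_, ?_, ⟨x, hx0, hxu, hx'⟩, ⟨z, hz0, hzu, hz⟩, fun y hy => ⟨hmin' y hy, hmax y hy⟩⟩
  · have h1 : 0 ≤ -m * (x ⬝ᵥ x) := by
      rw [← smul_eq_mul, ← dotProduct_smul, ← hx', dotProduct_lapMatrix_mulVec]
      positivity
    refine lt_of_le_of_ne (nonneg_of_mul_nonneg_left h1 hxx) fun h2 => ?_
    rw [← h2, zero_smul] at hx'
    have hc := fun i j => (SimpleGraph.lapMatrix_mulVec_eq_zero_iff_forall_reachable G).1 hx' i j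
      (hG.preconnected i j)
    obtain ⟨i, hi⟩ := Function.ne_iff.1 hx0
    have h3 : (1 : V → ℝ) ⬝ᵥ x = Fintype.card V * x i := by
      simp [dotProduct, fun j => hc j i]
    rw [h3] at hxu
    exact (mul_ne_zero (by simp) hi) hxu
  · have h1 := hmax x hxu
    rw [hx', dotProduct_smul, smul_eq_mul] at h1
    exact le_of_mul_le_mul_right h1 hxx

theorem gdMatrix_map_mulVec (α : ℝ) (v : V → ℂ) :
    ((gdMatrix G α).map (algebraMap ℝ ℂ)).mulVec v =
      v - (α : ℂ) • ((G.lapMatrix ℝ).map (algebraMap ℝ ℂ)).mulVec v := by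
  have h1 : (gdMatrix G α).map (algebraMap ℝ ℂ) =
      1 - (α : ℂ) • (G.lapMatrix ℝ).map (algebraMap ℝ ℂ) := by
    ext i j
    by_cases h : i = j <;> simp [gdMatrix, h]
  rw [h1, Matrix.sub_mulVec, Matrix.one_mulVec, Matrix.smul_mulVec]

theorem gdMatrix_map_mulVec_of_eigenvector {α μ : ℝ} {x : V → ℝ}
    (hx : (G.lapMatrix ℝ).mulVec x = μ • x) :
    ((gdMatrix G α).map (algebraMap ℝ ℂ)).mulVec (fun i => (x i : ℂ)) =
      ((1 - α * μ : ℝ) : ℂ) • fun i => (x i : ℂ) := by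
  rw [gdMatrix_map_mulVec]
  ext i
  have h1 := congrFun hx i
  have h2 : ((G.lapMatrix ℝ).map (algebraMap ℝ ℂ)).mulVec (fun i => (x i : ℂ)) i =
      ((G.lapMatrix ℝ).mulVec x i : ℝ) := by
    simp [Matrix.mulVec, dotProduct]
  simp only [Pi.sub_apply, Pi.smul_apply, smul_eq_mul, h2, h1]
  push_cast
  ring

theorem gd_isLeast [Nontrivial V] {m M : ℝ} (hm : 0 < m) (hmM : m ≤ M)
    (hxm : ∃ x : V → ℝ, x ≠ 0 ∧ 1 ⬝ᵥ x = 0 ∧ (G.lapMatrix ℝ).mulVec x = m • x)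
    (hxM : ∃ x : V → ℝ, x ≠ 0 ∧ 1 ⬝ᵥ x = 0 ∧ (G.lapMatrix ℝ).mulVec x = M • x)
    (hext : ∀ y : V → ℝ, 1 ⬝ᵥ y = 0 → m * (y ⬝ᵥ y) ≤ y ⬝ᵥ (G.lapMatrix ℝ).mulVec y ∧
        y ⬝ᵥ (G.lapMatrix ℝ).mulVec y ≤ M * (y ⬝ᵥ y)) :
    IsLeast (gdRates G) ((M - m) / (M + m)) := by
  have hM : 0 < M := hm.trans_le hmM
  have hMm : 0 < M + m := by positivity
  obtain ⟨x, hx0, -, hx⟩ := hxm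
  obtain ⟨z, hz0, -, hz⟩ := hxM
  have hcast : ∀ {x : V → ℝ}, x ≠ 0 → (fun i => (x i : ℂ)) ≠ 0 := by
    intro x hx0 h
    exact hx0 (funext fun i => by simpa using congrFun h i)
  have hne : ∀ {α μ : ℝ}, 0 < α → 0 < μ → ((1 - α * μ : ℝ) : ℂ) ≠ 1 := by
    intro α μ hα hμ h
    have h1 : 1 - α * μ = 1 := by exact_mod_cast h
    have := mul_pos hα hμ
    linarith
  constructor
  -- On vectors of sum zero the eigenvalues are `1 - αμ` with `m ≤ μ ≤ M`; this step size makes the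
  -- two extreme ones opposite.
  · set α := 2 / (M + m) with hαdef
    have hα : 0 < α := by positivity
    have hL1 : (G.lapMatrix ℝ).mulVec 1 = 0 := SimpleGraph.lapMatrix_mulVec_const_eq_zero G
    have hrow : (gdMatrix G α).mulVec 1 = 1 := by
      rw [gdMatrix, Matrix.sub_mulVec, Matrix.smul_mulVec, hL1, smul_zero, sub_zero,
        Matrix.one_mulVec]
    have hsymm : (gdMatrix G α).transpose = gdMatrix G α := by
      rw [gdMatrix, Matrix.transpose_sub, Matrix.transpose_smul, (G.isSymm_lapMatrix (R := ℝ)).eq,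
        Matrix.transpose_one]
    refine ⟨α, hα, hasRate_of_stochastic ?_ (fun i => ?_) (fun i => ?_)
      ⟨_, _, hne hα hm, ?_, hcast hx0, gdMatrix_map_mulVec_of_eigenvector hx⟩ ?_⟩
    · rw [div_lt_one hMm]; linarith
    · simpa [Matrix.mulVec, dotProduct] using congrFun hrow i
    · have h1 := congrFun hrow i
      rw [← hsymm] at h1
      simpa [Matrix.mulVec, dotProduct] using h1
    · rw [Complex.norm_real, Real.norm_eq_abs]
      have h1 : 1 - α * m = (M - m) / (M + m) := by rw [hαdef]; field_simp; ring
      rw [h1, abs_of_nonneg (div_nonneg (by linarith) hMm.le)]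
    · intro l v hv0 hsum hv
      rw [gdMatrix_map_mulVec] at hv
      have hα' : (α : ℂ) ≠ 0 := by exact_mod_cast hα.ne'
      obtain ⟨μ, y, hμ, hy0, hy, hyv⟩ := exists_real_eigenvector (M := G.lapMatrix ℝ)
        (d := 1) (l := (1 - l) / α) (G.isSymm_lapMatrix (R := ℝ))
        (fun _ => one_pos) hv0 (fun i => by
          have h1 := congrFun hv i
          simp only [Pi.sub_apply, Pi.smul_apply, smul_eq_mul] at h1
          have h2 : ((G.lapMatrix ℝ).map (algebraMap ℝ ℂ)).mulVec v i =
            ∑ j, ((G.lapMatrix ℝ i j : ℝ) : ℂ) * v j := rfl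
          rw [h2] at h1
          simp only [Pi.one_apply, Complex.ofReal_one, one_mul]
          rw [div_mul_eq_mul_div, eq_div_iff hα']
          linear_combination -h1)
      have hysum : 1 ⬝ᵥ y = 0 := by
        rw [one_dotProduct]
        rcases hyv with rfl | rfl
        · rw [← Complex.re_sum, hsum, Complex.zero_re]
        · rw [← Complex.im_sum, hsum, Complex.zero_im]
      rw [one_mul] at hy
      have hyy : 0 < y ⬝ᵥ y := by
        have := dotProduct_self_pos_of_pos (d := 1) (fun _ => one_pos) hy0
        rwa [one_mul] at this
      obtain ⟨h1, h2⟩ := hext y hysum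
      rw [hy, dotProduct_smul, smul_eq_mul] at h1 h2
      have h3 := le_of_mul_le_mul_right h1 hyy
      have h4 := le_of_mul_le_mul_right h2 hyy
      have h5 : l = ((1 - α * μ : ℝ) : ℂ) := by
        rw [div_eq_iff hα'] at hμ
        push_cast
        linear_combination -hμ
      rw [h5, Complex.norm_real, Real.norm_eq_abs]
      have h6 : α * (M + m) = 2 := by rw [hαdef]; field_simp
      rw [abs_le, ← neg_div, div_le_iff₀ hMm, le_div_iff₀ hMm]
      constructor <;> nlinarith
  · rintro τ ⟨α, hα, hrate⟩
    have h1 := hrate.norm_eigenvalue_le (hne hα hm) (hcast hx0)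
      (gdMatrix_map_mulVec_of_eigenvector hx)
    have h2 := hrate.norm_eigenvalue_le (hne hα hM) (hcast hz0)
      (gdMatrix_map_mulVec_of_eigenvector hz)
    rw [Complex.norm_real, Real.norm_eq_abs] at h1 h2
    -- Weighting `1 - αm ≤ τ` by `M` and `αM - 1 ≤ τ` by `m` eliminates `α`.
    have h3 := (le_abs_self _).trans h1
    have h4 := (neg_abs_le (1 - α * M))
    rw [div_le_iff₀ hMm]
    nlinarith

/-- Comparison of the least positive eigenvalue of the Laplacian with the spectral gap. -/
theorem minDegree_mul_spectralGap_le [Nontrivial V] (hG : G.Connected) {m : ℝ}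
    (hxm : ∃ x : V → ℝ, x ≠ 0 ∧ 1 ⬝ᵥ x = 0 ∧ (G.lapMatrix ℝ).mulVec x = m • x) :
    G.minDegree * spectralGap G ≤ m := by
  obtain ⟨x, hx0, hxu, hx⟩ := hxm
  obtain ⟨hω, -, hmax⟩ := omegaStar_spec hG
  have hd : 0 < ∑ i, deg G i := Finset.sum_pos (fun i _ => deg_pos hG i) Finset.univ_nonempty
  -- The shift makes `y` orthogonal to the degrees. It keeps the Laplacian form and can only
  -- increase the norm, since `x` has sum zero.
  set c := (deg G ⬝ᵥ x) / ∑ i, deg G i with hc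
  set y : V → ℝ := fun i => x i - c with hy
  have hdy : deg G ⬝ᵥ y = 0 := by
    have h1 : deg G ⬝ᵥ y = deg G ⬝ᵥ x - (∑ i, deg G i) * c := by
      simp only [hy, dotProduct, mul_sub, Finset.sum_sub_distrib, Finset.sum_mul]
    rw [h1, hc, mul_div_cancel₀ _ hd.ne', sub_self]
  have h1 := hmax y hdy
  have h2 : y ⬝ᵥ (G.lapMatrix ℝ).mulVec y = m * (x ⬝ᵥ x) := by
    rw [hy, dotProduct_lapMatrix_sub_const, hx, dotProduct_smul, smul_eq_mul]
  rw [lapMatrix_mulVec_eq, dotProduct_sub] at h2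
  have h3 : x ⬝ᵥ x ≤ y ⬝ᵥ y := by
    have := dotProduct_sub_const 1 x c
    rw [hxu, one_mul, one_mul] at this
    rw [hy, this]
    have h4 : 0 ≤ c ^ 2 * ∑ i : V, (1 : V → ℝ) i :=
      mul_nonneg (sq_nonneg c) (Finset.sum_nonneg fun _ _ => zero_le_one)
    linarith
  have h4 : G.minDegree * (y ⬝ᵥ y) ≤ y ⬝ᵥ (deg G * y) := by
    simp only [dotProduct, Pi.mul_apply, Finset.mul_sum]
    refine Finset.sum_le_sum fun i _ => ?_
    nlinarith [mul_le_mul_of_nonneg_right (minDegree_le_deg (G := G) i) (mul_self_nonneg (y i))]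
  have h5 : 0 < x ⬝ᵥ x := by
    have := dotProduct_self_pos_of_pos (d := 1) (fun _ => one_pos) hx0
    rwa [one_mul] at this
  refine le_of_mul_le_mul_right ?_ h5
  have h6 : 0 ≤ spectralGap G := by rw [spectralGap]; linarith
  calc G.minDegree * spectralGap G * (x ⬝ᵥ x) ≤ G.minDegree * spectralGap G * (y ⬝ᵥ y) :=
        mul_le_mul_of_nonneg_left h3 (by positivity)
    _ = spectralGap G * (G.minDegree * (y ⬝ᵥ y)) := by ring
    _ ≤ spectralGap G * (y ⬝ᵥ (deg G * y)) := mul_le_mul_of_nonneg_left h4 h6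
    _ ≤ m * (x ⬝ᵥ x) := by rw [spectralGap]; linarith

/-- Mirror image of the preceding comparison: the walk eigenvector for `ω⋆` is shifted to sum zero,
which can only increase its degree-weighted norm. -/
theorem le_maxDegree_mul_spectralGap [Nontrivial V] (hG : G.Connected) {m : ℝ}
    (hmin : ∀ y : V → ℝ, 1 ⬝ᵥ y = 0 → m * (y ⬝ᵥ y) ≤ y ⬝ᵥ (G.lapMatrix ℝ).mulVec y) :
    m ≤ G.maxDegree * spectralGap G := by
  obtain ⟨hω, ⟨x, hx0, hxu, hx⟩, -⟩ := omegaStar_spec hG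
  have hn : (Fintype.card V : ℝ) ≠ 0 := by simp
  set c := (∑ i, x i) / Fintype.card V with hc
  set y : V → ℝ := fun i => x i - c with hy
  have hy1 : 1 ⬝ᵥ y = 0 := by
    rw [one_dotProduct]
    simp only [hy, Finset.sum_sub_distrib, Finset.sum_const, Finset.card_univ, nsmul_eq_mul]
    rw [hc, mul_div_cancel₀ _ hn, sub_self]
  have h1 := hmin y hy1
  have h2 : y ⬝ᵥ (G.lapMatrix ℝ).mulVec y = spectralGap G * (x ⬝ᵥ (deg G * x)) := by
    rw [hy, dotProduct_lapMatrix_sub_const, lapMatrix_mulVec_eq, dotProduct_sub, hx,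
      dotProduct_smul, smul_eq_mul, spectralGap]
    ring
  have hxx := dotProduct_self_pos_of_pos (deg_pos hG) hx0
  have h3 : x ⬝ᵥ (deg G * x) ≤ y ⬝ᵥ (deg G * y) := by
    rw [hy, dotProduct_sub_const, hxu]
    have h4 : 0 ≤ c ^ 2 * ∑ i : V, deg G i :=
      mul_nonneg (sq_nonneg c) (Finset.sum_nonneg fun i _ => (deg_pos hG i).le)
    linarith
  have h4 : y ⬝ᵥ (deg G * y) ≤ G.maxDegree * (y ⬝ᵥ y) := by
    simp only [dotProduct, Pi.mul_apply, Finset.mul_sum]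
    refine Finset.sum_le_sum fun i _ => ?_
    nlinarith [mul_le_mul_of_nonneg_right (deg_le_maxDegree (G := G) i) (mul_self_nonneg (y i))]
  have h5 : 0 < y ⬝ᵥ y := by
    have h6 := hxx.trans_le (h3.trans h4)
    exact pos_of_mul_pos_right h6 (Nat.cast_nonneg _)
  refine le_of_mul_le_mul_right ?_ h5
  have h6 : 0 ≤ spectralGap G := by rw [spectralGap]; linarith
  calc m * (y ⬝ᵥ y) ≤ spectralGap G * (x ⬝ᵥ (deg G * x)) := h2 ▸ h1
    _ ≤ spectralGap G * (G.maxDegree * (y ⬝ᵥ y)) :=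
        mul_le_mul_of_nonneg_left (h3.trans h4) h6
    _ = G.maxDegree * spectralGap G * (y ⬝ᵥ y) := by ring

theorem lapMatrix_eigenvalue_le {M : ℝ}
    (hxM : ∃ x : V → ℝ, x ≠ 0 ∧ 1 ⬝ᵥ x = 0 ∧ (G.lapMatrix ℝ).mulVec x = M • x) :
    M ≤ 2 * G.maxDegree := by
  obtain ⟨x, hx0, -, hx⟩ := hxM
  have h1 := dotProduct_lapMatrix_le (G := G) x
  rw [hx, dotProduct_smul, smul_eq_mul] at h1
  have h4 : x ⬝ᵥ (deg G * x) ≤ G.maxDegree * (x ⬝ᵥ x) := by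
    simp only [dotProduct, Pi.mul_apply, Finset.mul_sum]
    refine Finset.sum_le_sum fun i _ => ?_
    nlinarith [mul_le_mul_of_nonneg_right (deg_le_maxDegree (G := G) i) (mul_self_nonneg (x i))]
  have h5 : 0 < x ⬝ᵥ x := by
    have := dotProduct_self_pos_of_pos (d := 1) (fun _ => one_pos) hx0
    rwa [one_mul] at this
  exact le_of_mul_le_mul_right (by linarith) h5

/-- The test vector is the indicator of a node of maximum degree minus its mean: its Laplacian form
is the degree, and its squared norm is at most `1`. -/
theorem maxDegree_le_of_lapMatrix_le [Nonempty V] {M : ℝ} (hM : 0 ≤ M)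
    (hmax : ∀ y : V → ℝ, 1 ⬝ᵥ y = 0 → y ⬝ᵥ (G.lapMatrix ℝ).mulVec y ≤ M * (y ⬝ᵥ y)) :
    G.maxDegree ≤ M := by
  obtain ⟨v, hv⟩ := G.exists_maximal_degree_vertex
  have hn : (0 : ℝ) < Fintype.card V := by exact_mod_cast Fintype.card_pos
  set c : ℝ := (Fintype.card V : ℝ)⁻¹ with hc
  have hcn : c * Fintype.card V = 1 := inv_mul_cancel₀ hn.ne'
  set e : V → ℝ := Pi.single v 1 with he
  set y : V → ℝ := fun i => e i - c with hy
  have hy1 : 1 ⬝ᵥ y = 0 := by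
    rw [one_dotProduct]
    simp only [hy, Finset.sum_sub_distrib, Finset.sum_const, Finset.card_univ, nsmul_eq_mul]
    simp [he, hc]
  have h1 := hmax y hy1
  have h2 : y ⬝ᵥ (G.lapMatrix ℝ).mulVec y = G.maxDegree := by
    rw [hy, dotProduct_lapMatrix_sub_const, he, single_one_dotProduct,
      SimpleGraph.lapMatrix_mulVec_apply, hv]
    simp
  have h3 : y ⬝ᵥ y ≤ 1 := by
    have := dotProduct_sub_const 1 e c
    rw [one_mul, one_mul] at this
    rw [hy, this]
    have h4 : e ⬝ᵥ e = 1 := by simp [he]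
    have h5 : (1 : V → ℝ) ⬝ᵥ e = 1 := by simp [he]
    have h6 : ∑ i : V, (1 : V → ℝ) i = Fintype.card V := by simp
    have h7 : 0 ≤ c := by positivity
    rw [h4, h5, h6]
    nlinarith
  rw [h2] at h1
  nlinarith

end Graph

/-! ### The speedup -/

/-- The function `C(δ) = 1 - O(√δ)`. -/
def speedupFactor (δ : ℝ) : ℝ :=
  (4 - 4 * (1 - optParam (1 - δ)) + 3 * (1 - optParam (1 - δ)) ^ 2) /
    (2 + (1 - optParam (1 - δ))) ^ 2

theorem optParam_gap {δ : ℝ} (h0 : 0 < δ) (h1 : δ ≤ 1) : 0 < 1 - optParam (1 - δ) ∧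
    1 - optParam (1 - δ) ≤ 1 ∧
    δ * (1 + optParam (1 - δ) ^ 2) = (1 - optParam (1 - δ)) ^ 2 := by
  have h2 := optParam_nonneg (sub_nonneg.2 h1)
  have h3 := optParam_lt_one (sub_lt_self 1 h0)
  have h4 := mul_one_add_optParam_sq (sub_nonneg.2 h1) (sub_lt_self 1 h0)
  exact ⟨by linarith, by linarith, by linarith⟩

theorem speedupFactor_bounds {δ : ℝ} (h0 : 0 < δ) (h1 : δ ≤ 1) : 0 < speedupFactor δ ∧
    0 ≤ 1 - speedupFactor δ ∧ 1 - speedupFactor δ ≤ 3 * √δ := by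
  obtain ⟨hx0, hx1, hx⟩ := optParam_gap h0 h1
  rw [speedupFactor]
  set x := 1 - optParam (1 - δ) with hxdef
  have hs : optParam (1 - δ) = 1 - x := by rw [hxdef]; ring
  rw [hs] at hx
  have h2 : 0 < (2 + x) ^ 2 := by positivity
  have h3 : 1 - (4 - 4 * x + 3 * x ^ 2) / (2 + x) ^ 2 = (8 * x - 2 * x ^ 2) / (2 + x) ^ 2 := by
    field_simp; ring
  refine ⟨div_pos (by nlinarith [sq_nonneg (2 - x)]) h2, ?_, ?_⟩
  · rw [h3]; exact div_nonneg (by nlinarith) h2.le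
  -- In terms of `x = 1 - s` the gap relation reads `x² = δ(2 - 2x + x²) ≤ 2δ`; the constant `3/2`
  -- is a rational bound for `√2`.
  · have h4 : x ≤ 3 / 2 * √δ := by
      refine le_of_sq_le_sq ?_ (by positivity)
      rw [mul_pow, Real.sq_sqrt h0.le]
      nlinarith [mul_pos h0 (mul_pos hx0 (show 0 < 2 - x by linarith))]
    rw [h3]
    refine le_trans ?_ (show 2 * x ≤ 3 * √δ by linarith)
    rw [div_le_iff₀ h2]
    nlinarith [mul_pos hx0 hx0]

/-- The pivot is `4δ/(2 + δ)`. It dominates the gradient-descent gap `2m/(M + m)`, because `m ≤ Dδ`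
and `M ≥ D`, and is at most `2D/d` times that gap, because `m ≥ dδ` and `M ≤ 2D`. -/
theorem speedup_bounds {s δ m M D d : ℝ} (hs0 : 0 ≤ s) (hs1 : s < 1) (hδ0 : 0 < δ)
    (hδ : δ * (1 + s ^ 2) = (1 - s) ^ 2) (hm : 0 < m) (hd : 0 < d) (hdD : d ≤ D)
    (hm1 : d * δ ≤ m) (hm2 : m ≤ D * δ) (hM1 : D ≤ M) (hM2 : M ≤ 2 * D) {C : ℝ}
    (hC : C = (4 - 4 * (1 - s) + 3 * (1 - s) ^ 2) / (2 + (1 - s)) ^ 2) :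
    C * (1 - (M - m) / (M + m)) ≤ (1 - (1 + s) / (3 - s)) ^ 2 ∧
    (1 - (1 + s) / (3 - s)) ^ 2 ≤ 2 * (D / d) * C * (1 - (M - m) / (M + m)) ∧
    1 / 3 * √(1 - (M - m) / (M + m)) ≤ 1 - (1 + s) / (3 - s) := by
  have hD : 0 < D := hd.trans_le hdD
  have hM : 0 < M := hD.trans_le hM1
  have h3s : 0 < 3 - s := by linarith
  have hG : 1 - (M - m) / (M + m) = 2 * m / (M + m) := by field_simp; ring
  have hA : 1 - (1 + s) / (3 - s) = 2 * (1 - s) / (3 - s) := by field_simp; ring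
  have hC0 : 0 ≤ C := by
    rw [hC]
    exact div_nonneg (by nlinarith [sq_nonneg (2 - (1 - s))]) (sq_nonneg _)
  -- `C` is the ratio of the squared ADMM gap to `4δ/(2 + δ)`, with `δ` expressed through `s`.
  have hAC : (2 * (1 - s) / (3 - s)) ^ 2 = C * (4 * δ / (2 + δ)) := by
    have h1 : 0 < 1 + s ^ 2 := by positivity
    have h2 : δ = (1 - s) ^ 2 / (1 + s ^ 2) := by rw [← hδ]; field_simp
    have h4 : 4 * δ / (2 + δ) =
        4 * (1 - s) ^ 2 / (4 - 4 * (1 - s) + 3 * (1 - s) ^ 2) := by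
      have h5 : 0 < 4 - 4 * (1 - s) + 3 * (1 - s) ^ 2 := by nlinarith [sq_nonneg (2 - (1 - s))]
      rw [div_eq_div_iff (by positivity) h5.ne']
      linear_combination 8 * hδ
    have h5 : 0 < 4 - 4 * (1 - s) + 3 * (1 - s) ^ 2 := by nlinarith [sq_nonneg (2 - (1 - s))]
    have h6 : 2 + (1 - s) = 3 - s := by ring
    rw [h4, hC, h6]
    generalize 4 - 4 * (1 - s) + 3 * (1 - s) ^ 2 = E at h5
    field_simp
    ring
  have hup : 2 * m / (M + m) ≤ 4 * δ / (2 + δ) := by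
    rw [div_le_div_iff₀ (by positivity) (by positivity)]
    nlinarith [mul_le_mul_of_nonneg_right hM1 hδ0.le, mul_nonneg hm.le hδ0.le]
  have hDd : d * (D / d) = D := by field_simp
  have hDd1 : 1 ≤ D / d := by rwa [one_le_div hd]
  have hlow : 4 * δ / (2 + δ) ≤ 2 * (D / d) * (2 * m / (M + m)) := by
    rw [← mul_div_assoc, div_le_div_iff₀ (by positivity) (by positivity)]
    have h1 : D * δ ≤ D / d * m := by
      have := mul_le_mul_of_nonneg_left hm1 (show 0 ≤ D / d by positivity)
      calc D * δ = D / d * (d * δ) := by rw [← mul_assoc, mul_comm (D / d), hDd]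
        _ ≤ D / d * m := this
    have h2 : M * δ ≤ 2 * (D / d * m) := by nlinarith
    have h3 : m * δ ≤ D / d * m * δ := by
      nlinarith [mul_le_mul_of_nonneg_right hDd1 (mul_nonneg hm.le hδ0.le)]
    nlinarith
  rw [hG, hA]
  refine ⟨?_, ?_, ?_⟩
  · rw [hAC]; exact mul_le_mul_of_nonneg_left hup hC0
  · rw [hAC]
    calc C * (4 * δ / (2 + δ)) ≤ C * (2 * (D / d) * (2 * m / (M + m))) :=
          mul_le_mul_of_nonneg_left hlow hC0
      _ = 2 * (D / d) * C * (2 * m / (M + m)) := by ring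
  -- The constant `1/3` comes from `√(2δ) ≤ 2(1 - s)` and `3 - s ≤ 3`.
  · have h1 : 2 * m / (M + m) ≤ 2 * δ := by
      refine hup.trans ?_
      rw [div_le_iff₀ (by positivity)]
      nlinarith
    have h2 : √(2 * m / (M + m)) ≤ 2 * (1 - s) := by
      rw [Real.sqrt_le_left (by linarith)]
      nlinarith [mul_nonneg hδ0.le (sq_nonneg s)]
    have h3 : 2 * (1 - s) / 3 ≤ 2 * (1 - s) / (3 - s) :=
      div_le_div_of_nonneg_left (by linarith) h3s (by linarith)
    linarith

theorem HasEvenCycle.nontrivial {V : Type*} {G : SimpleGraph V} (h : HasEvenCycle G) :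
    Nontrivial V := by
  obtain ⟨v, c, hc, -⟩ := h
  cases c with
  | nil => exact absurd rfl hc.ne_nil
  | cons h p => exact ⟨_, _, h.ne⟩

end ADMMSpeedup

end

theorem theorem5 :
    ∃ (K : ℝ) (C : ℝ → ℝ) (c : ℝ),
      (∀ δ : ℝ, 0 < δ → δ ≤ 1 → 0 < C δ ∧ 0 ≤ 1 - C δ ∧ 1 - C δ ≤ K * √δ) ∧
      0 < c ∧
      ∀ (V : Type*) [Fintype V] [DecidableEq V] (G : SimpleGraph V) [DecidableRel G.Adj],
        G.Connected →
        ADMMSpeedup.HasEvenCycle G →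
        ADMMSpeedup.conductance G ≤ 1 / 2 →
        -- the optimal rates are attained, and the one of ADMM is the minimum of `|λ₂(T_A)|`
        IsLeast (ADMMSpeedup.admmRates G) (ADMMSpeedup.admmOptRate G) ∧
        IsLeast (ADMMSpeedup.admmSecondModuli G) (ADMMSpeedup.admmOptRate G) ∧
        IsLeast (ADMMSpeedup.gdRates G) (ADMMSpeedup.gdOptRate G) ∧
        -- the spectral gap is in the range where `C` is controlled
        0 < ADMMSpeedup.spectralGap G ∧ ADMMSpeedup.spectralGap G ≤ 1 ∧
        -- the two bounds
        C (ADMMSpeedup.spectralGap G) * (1 - ADMMSpeedup.gdOptRate G)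
          ≤ (1 - ADMMSpeedup.admmOptRate G) ^ 2 ∧
        (1 - ADMMSpeedup.admmOptRate G) ^ 2
          ≤ 2 * ADMMSpeedup.degreeRatio G * C (ADMMSpeedup.spectralGap G)
            * (1 - ADMMSpeedup.gdOptRate G) ∧
        -- the square-root speedup
        c * √(1 - ADMMSpeedup.gdOptRate G) ≤ 1 - ADMMSpeedup.admmOptRate G := by
  refine ⟨3, ADMMSpeedup.speedupFactor, 1 / 3,
    fun δ h0 h1 => ADMMSpeedup.speedupFactor_bounds h0 h1, by norm_num, ?_⟩
  intro V _ _ G _ hG hc hΦ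
  -- A cycle has two distinct nodes, so in a connected graph all degrees are positive and `W` is a
  -- genuine walk.
  have := hc.nontrivial
  have hω1 := (ADMMSpeedup.omegaStar_spec hG).1
  have hω0 := ADMMSpeedup.omegaStar_nonneg hG hΦ
  obtain ⟨hA, hA2⟩ := ADMMSpeedup.admm_isLeast hG hc hω0
  obtain ⟨m, M, hm, hmM, hxm, hxM, hext⟩ := ADMMSpeedup.exists_extremal_lapMatrix_eigenvalues hG
  have hgd := ADMMSpeedup.gd_isLeast hm hmM hxm hxM hext
  have hAeq : ADMMSpeedup.admmOptRate G = _ := hA.csInf_eq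
  have hGeq : ADMMSpeedup.gdOptRate G = _ := hgd.csInf_eq
  have hδ0 : 0 < ADMMSpeedup.spectralGap G := sub_pos.2 hω1
  have hδ1 : ADMMSpeedup.spectralGap G ≤ 1 := sub_le_self 1 hω0
  have hsub : 1 - ADMMSpeedup.spectralGap G = ADMMSpeedup.omegaStar G := sub_sub_cancel _ _
  have hgap := (ADMMSpeedup.optParam_gap hδ0 hδ1).2.2
  rw [hsub] at hgap
  have hmin : (0 : ℝ) < G.minDegree := by
    obtain ⟨v, hv⟩ := G.exists_minimal_degree_vertex
    rw [hv]
    exact ADMMSpeedup.deg_pos hG v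
  rw [hAeq, hGeq]
  refine ⟨hA, hA2, hgd, hδ0, hδ1, ?_⟩
  exact ADMMSpeedup.speedup_bounds (ADMMSpeedup.optParam_nonneg hω0)
    (ADMMSpeedup.optParam_lt_one hω1) hδ0 hgap hm hmin
    (Nat.cast_le.2 G.minDegree_le_maxDegree)
    (ADMMSpeedup.minDegree_mul_spectralGap_le hG hxm)
    (ADMMSpeedup.le_maxDegree_mul_spectralGap hG fun y hy => (hext y hy).1)
    (ADMMSpeedup.maxDegree_le_of_lapMatrix_le (hm.trans_le hmM).le fun y hy => (hext y hy).2)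
    (ADMMSpeedup.lapMatrix_eigenvalue_le hxM)
    (by rw [ADMMSpeedup.speedupFactor, hsub])
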